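/- Let $S$ be a complex manifold and let $\mathcal V\to S$ be a variation of graded-polarized mixed Hodge structure: a local system $\mathcal V_{\mathbb Q}$ of finite-dimensional $\mathbb Q$-vector spaces on $S$ with (1) a finite increasing weight filtration $\mathcal W_\bullet$ by rational local subsystems; (2) a finite decreasing Hodge filtration $\mathcal F^\bullet$ of $\mathcal V_{\mathbb Q}\otimes\mathcal O_S$ by holomorphic subbundles, with $\nabla\mathcal F^p\subseteq\Omega^1_S\otimes\mathcal F^{p-1}$ for the Gauss–Manin connection $\nabla=1\otimes d$; (3) for each $k$, a rational, non-degenerate, $(-1)^k$-symmetric bilinear form $\mathcal S_k$ on $Gr^{\mathcal W}_k(\mathcal V_{\mathbb Q})=\mathcal W_k/\mathcal W_{k-1}$, such that $(Gr^{\mathcal W}_k(\mathcal V_{\mathbb Q}),\mathcal F\,Gr^{\mathcal W}_k,\mathcal S_k)$ is a variation of pure polarized Hodge structure of weight $k$. For every $s\in S$ there is a unique decomposition $\mathcal V_s=\bigoplus_{p,q}I^{p,q}_s$ of $\mathcal V_s=\mathcal V_{\mathbb Q,s}\otimes\mathbb C$ (the Deligne splitting of $(\mathcal F_s,\mathcal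 W_s)$) such that $$\mathcal F^p_s=\bigoplus_{r\ge p,\,t}I_s^{r,t},\qquad \mathcal W_{k,s}\otimes\mathbb C=\bigoplus_{r+t\le k}I_s^{r,t},\qquad I_s^{p,q}\equiv\overline{I_s^{q,p}}\ \bmod\ \bigoplus_{r<p,\,t<q}I_s^{r,t}.$$ Put $\mathcal U^p_s=\bigoplus_q I^{p,q}_s$. Then the decomposition $\mathcal V=\bigoplus_p\mathcal U^p$ of the $C^\infty$ vector bundle $\mathcal V=\mathcal V_{\mathbb Q}\otimes\mathcal E^0_S$, together with the flat connection $\nabla$, is an (unpolarized) complex variation of Hodge structure. That is, each $\mathcal U^p$ is a $C^\infty$ subbundle, $\mathcal V_s=\bigoplus_p\mathcal U^p_s$ for every $s$, and over every open subset of $S$ $$\nabla:\mathcal E^0(\mathcal U^p)\to\mathcal E^{0,1}(\mathcal U^{p+1})\oplus\mathcal E^{0,1}(\mathcal U^p)\oplus\mathcal E^{1,0}(\mathcal U^p)\oplus\mathcal E^{1,0}(\mathcal U^{p-1})\qquad\text{for all }p,$$ where $\mathcal E^{a,b}(\mathcal U)$ denotes the smooth $(a,b)$-forms with values in $\mathcal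 U$. -/

import Mathlib

open scoped Manifold ContDiff TensorProduct Topology
open Filter

universe u v w

noncomputable section

/-! ## Local systems -/

/-- A local system of finite-dimensional `K`-vector spaces on `S`, given by its stalks and by
germs of parallel transport: `transport x s : L_s → L_x` is the isomorphism given by the local
system for `s` close to `x` (the value for other `s` carries no information). Equivalently, a
family `σ` is a flat section near `x` iff `transport x s (σ s) = σ x` for all `s` near `x`. -/
structure LocalSystem (K : Type w) [Field K] (S : Type u) [TopologicalSpace S] where
  fiber : S → Type v
  [addCommGroup : ∀ s, AddCommGroup (fiber s)]
  [module : ∀ s, Module K (fiber s)]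
  [finite : ∀ s, FiniteDimensional K (fiber s)]
  transport : ∀ x s, fiber s →ₗ[K] fiber x
  transport_self : ∀ x, transport x x = LinearMap.id
  transport_bijective : ∀ x, ∀ᶠ s in 𝓝 x, Function.Bijective (transport x s)
  transport_comp : ∀ x, ∀ᶠ s in 𝓝 x, ∀ᶠ t in 𝓝 s,
    transport x s ∘ₗ transport s t = transport x t

attribute [instance] LocalSystem.addCommGroup LocalSystem.module LocalSystem.finite

namespace LocalSystem

section Algebra

variable {K : Type w} [Field K] {S : Type u} [TopologicalSpace S]

/-- A family of subspaces of the stalks is a local subsystem if it is preserved by the local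
parallel transport. -/
def IsFlatSub (L : LocalSystem.{u, v, w} K S) (A : ∀ s, Submodule K (L.fiber s)) : Prop :=
  ∀ x, ∀ᶠ s in 𝓝 x, (A s).map (L.transport x s) = A x

/-- The map `A/(A ∩ B) → A'/(A' ∩ B')` induced by `T : M → M'`, if `T` maps `A` into `A'` and `B`
into `B'` (and zero otherwise). -/
def subquotientMap {M M' : Type v} [AddCommGroup M] [Module K M] [AddCommGroup M'] [Module K M']
    (T : M →ₗ[K] M') (A B : Submodule K M) (A' B' : Submodule K M') :
    (A ⧸ B.submoduleOf A) →ₗ[K] (A' ⧸ B'.submoduleOf A') :=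
  open Classical in
  if h : A.map T ≤ A' ∧ B.map T ≤ B' then
    Submodule.mapQ _ _ (T.restrict fun _ hm => h.1 (Submodule.mem_map_of_mem hm))
      fun m hm => h.2 (Submodule.mem_map_of_mem (f := T) (r := (m : M)) hm)
  else 0

theorem subquotientMap_mk {M M' : Type v} [AddCommGroup M] [Module K M] [AddCommGroup M']
    [Module K M'] {T : M →ₗ[K] M'} {A B : Submodule K M} {A' B' : Submodule K M'}
    (hA : A.map T ≤ A') (hB : B.map T ≤ B') (m : A) :
    subquotientMap T A B A' B' (Submodule.Quotient.mk m) =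
      Submodule.Quotient.mk ⟨T m, hA (Submodule.mem_map_of_mem m.2)⟩ := by
  rw [subquotientMap, dif_pos ⟨hA, hB⟩]
  rfl

/-- The quotient `A/(A ∩ B)` of local subsystems `A`, `B` of `L`. -/
def subquotient (L : LocalSystem.{u, v, w} K S) (A B : ∀ s, Submodule K (L.fiber s))
    (hA : L.IsFlatSub A) (hB : L.IsFlatSub B) : LocalSystem.{u, v, w} K S where
  fiber s := A s ⧸ (B s).submoduleOf (A s)
  transport x s := subquotientMap (L.transport x s) (A s) (B s) (A x) (B x)
  transport_self x := by
    refine LinearMap.ext fun m => ?_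
    obtain ⟨m, rfl⟩ := Submodule.Quotient.mk_surjective _ m
    rw [subquotientMap_mk (by simp [L.transport_self]) (by simp [L.transport_self])]
    simp [L.transport_self]
  transport_bijective x := by
    filter_upwards [L.transport_bijective x, hA x, hB x] with s hs h1 h2
    refine ⟨(injective_iff_map_eq_zero _).2 fun m hm => ?_, fun m => ?_⟩
    · obtain ⟨m, rfl⟩ := Submodule.Quotient.mk_surjective _ m
      rw [subquotientMap_mk h1.le h2.le, Submodule.Quotient.mk_eq_zero] at hm
      have hm' : L.transport x s m ∈ B x := hm
      rw [← h2] at hm'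
      obtain ⟨b, hb, hbm⟩ := hm'
      rw [Submodule.Quotient.mk_eq_zero]
      change (m : L.fiber s) ∈ B s
      rw [← hs.1 hbm]
      exact hb
    · obtain ⟨⟨m, hm⟩, rfl⟩ := Submodule.Quotient.mk_surjective _ m
      have hm' := hm
      rw [← h1] at hm'
      obtain ⟨a, ha, rfl⟩ := hm'
      exact ⟨Submodule.Quotient.mk ⟨a, ha⟩, subquotientMap_mk h1.le h2.le _⟩
  transport_comp x := by
    filter_upwards [L.transport_comp x, hA x, hB x, (hA x).eventually_nhds,
      (hB x).eventually_nhds] with s hs h1 h2 h3 h4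
    filter_upwards [hs, hA s, hB s, h3, h4] with t ht h5 h6 h7 h8
    refine LinearMap.ext fun m => ?_
    obtain ⟨m, rfl⟩ := Submodule.Quotient.mk_surjective _ m
    rw [LinearMap.comp_apply, subquotientMap_mk h5.le h6.le, subquotientMap_mk h1.le h2.le,
      subquotientMap_mk h7.le h8.le]
    simp [← ht]

/-- The complex local system `L ⊗ ℂ` of a rational local system `L`. -/
abbrev complexify (L : LocalSystem.{u, v, 0} ℚ S) : LocalSystem.{u, v, 0} ℂ S where
  fiber s := ℂ ⊗[ℚ] L.fiber s
  transport x s := (L.transport x s).baseChange ℂ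
  transport_self x := by simp [L.transport_self]
  transport_bijective x := by
    filter_upwards [L.transport_bijective x] with s hs
    exact ((LinearEquiv.ofBijective _ hs).baseChange ℚ ℂ _ _).bijective
  transport_comp x := by
    filter_upwards [L.transport_comp x] with s hs
    filter_upwards [hs] with t ht
    rw [← ht, LinearMap.baseChange_comp]

end Algebra

/-! ## Sections, forms and the flat connection of a complex local system

`S` is a complex manifold modelled on `E`; its tangent spaces are complex vector spaces. The
smooth vector bundle of a complex local system `L` is `L ⊗ C^∞`, its holomorphic vector bundle is
`L ⊗ 𝒪`, and the flat connection is `1 ⊗ d`. Near `x` the local parallel transport identifies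
sections with functions with values in the vector space `L_x`; the regularity of such a function is
that of its compositions with the linear functionals of `L_x`. -/

section Analysis

variable (E : Type w) [NormedAddCommGroup E] [NormedSpace ℂ E]
  {S : Type u} [TopologicalSpace S] [ChartedSpace E S]

/-- `σ` is a `C^∞` section (for the real smooth structure of `S`) at `x`. -/
def SmoothAt (L : LocalSystem.{u, v, 0} ℂ S) (σ : ∀ s, L.fiber s) (x : S) : Prop :=
  ∀ l : L.fiber x →ₗ[ℂ] ℂ,
    ContMDiffAt 𝓘(ℝ, E) 𝓘(ℝ, ℂ) ∞ (fun s => l (L.transport x s (σ s))) x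

/-- `σ` is a holomorphic section at `x`. -/
def HolomorphicAt (L : LocalSystem.{u, v, 0} ℂ S) (σ : ∀ s, L.fiber s) (x : S) : Prop :=
  ∀ l : L.fiber x →ₗ[ℂ] ℂ,
    ContMDiffAt 𝓘(ℂ, E) 𝓘(ℂ, ℂ) ω (fun s => l (L.transport x s (σ s))) x

/-- The real differential at `x` of a complex valued function on `S`, as a real linear form on the
tangent space `T_x S` `= E`. -/
def realDifferential (f : S → ℂ) (x : S) : E →ₗ[ℝ] ℂ :=
  (mfderiv 𝓘(ℝ, E) 𝓘(ℝ, ℂ) f x).toLinearMap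

/-- The flat (Gauss–Manin) connection: `L.nabla E σ x ξ = ∇_ξ σ ∈ L_x` for a real tangent vector
`ξ ∈ T_x S = E`. In the local flat trivialization at `x` it is the differential of the vector valued
function `s ↦ transport x s (σ s)`, computed here in a basis of `L_x`. -/
def nabla (L : LocalSystem.{u, v, 0} ℂ S) (σ : ∀ s, L.fiber s) (x : S) : E →ₗ[ℝ] L.fiber x :=
  ∑ i, (realDifferential E
      (fun s => (Module.finBasis ℂ (L.fiber x)).coord i (L.transport x s (σ s))) x).smulRight
    (Module.finBasis ℂ (L.fiber x) i)

/-- Smooth subbundles of `L ⊗ C^∞`: locally spanned by a pointwise independent smooth frame. -/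
def IsSmoothSubbundle (L : LocalSystem.{u, v, 0} ℂ S) (A : ∀ s, Submodule ℂ (L.fiber s)) : Prop :=
  ∀ x, ∃ O : Set S, IsOpen O ∧ x ∈ O ∧ ∃ (k : ℕ) (e : Fin k → ∀ s, L.fiber s),
    (∀ i, ∀ s ∈ O, L.SmoothAt E (e i) s) ∧
    ∀ s ∈ O, LinearIndependent ℂ (fun i => e i s) ∧
      Submodule.span ℂ (Set.range fun i => e i s) = A s

/-- Holomorphic subbundles of `L ⊗ 𝒪`. -/
def IsHolomorphicSubbundle (L : LocalSystem.{u, v, 0} ℂ S)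
    (A : ∀ s, Submodule ℂ (L.fiber s)) : Prop :=
  ∀ x, ∃ O : Set S, IsOpen O ∧ x ∈ O ∧ ∃ (k : ℕ) (e : Fin k → ∀ s, L.fiber s),
    (∀ i, ∀ s ∈ O, L.HolomorphicAt E (e i) s) ∧
    ∀ s ∈ O, LinearIndependent ℂ (fun i => e i s) ∧
      Submodule.span ℂ (Set.range fun i => e i s) = A s

/-- Griffiths transversality `∇ F^p ⊆ Ω¹ ⊗ F^{p-1}` for a filtration by holomorphic subbundles:
derivatives of local holomorphic sections of `F^p` lie in `F^{p-1}`. -/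
def IsTransversal (L : LocalSystem.{u, v, 0} ℂ S)
    (F : ℤ → ∀ s, Submodule ℂ (L.fiber s)) : Prop :=
  ∀ (p : ℤ) (O : Set S), IsOpen O → ∀ σ : ∀ s, L.fiber s,
    (∀ s ∈ O, L.HolomorphicAt E σ s ∧ σ s ∈ F p s) →
    ∀ x ∈ O, ∀ ξ, L.nabla E σ x ξ ∈ F (p - 1) x

variable [IsManifold 𝓘(ℂ, E) ω S]

/-- `α` is a `C^∞` `L`-valued 1-form at `x`: for each `v`, its value on the vector field which is
constant equal to `v` in the chart at `x` is a smooth section. -/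
def SmoothFormAt (L : LocalSystem.{u, v, 0} ℂ S)
    (α : ∀ s : S, E →ₗ[ℝ] L.fiber s) (x : S) : Prop :=
  ∀ v : E, L.SmoothAt E (fun s => α s (tangentCoordChange 𝓘(ℂ, E) x s s v)) x

/-- `α ∈ 𝓔^{1,0}(O, A)`: a smooth 1-form on `O` with values in `A ⊆ L`, complex linear on tangent
vectors. -/
structure IsForm10 (L : LocalSystem.{u, v, 0} ℂ S) (O : Set S)
    (A : ∀ s, Submodule ℂ (L.fiber s))
    (α : ∀ s : S, E →ₗ[ℝ] L.fiber s) : Prop where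
  smooth : ∀ s ∈ O, L.SmoothFormAt E α s
  mem : ∀ s ∈ O, ∀ ξ, α s ξ ∈ A s
  linear : ∀ s ∈ O, ∀ (c : ℂ) ξ, α s (c • ξ) = c • α s ξ

/-- `α ∈ 𝓔^{0,1}(O, A)`: a smooth 1-form on `O` with values in `A ⊆ L`, conjugate linear on tangent
vectors. -/
structure IsForm01 (L : LocalSystem.{u, v, 0} ℂ S) (O : Set S)
    (A : ∀ s, Submodule ℂ (L.fiber s))
    (α : ∀ s : S, E →ₗ[ℝ] L.fiber s) : Prop where
  smooth : ∀ s ∈ O, L.SmoothFormAt E α s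
  mem : ∀ s ∈ O, ∀ ξ, α s ξ ∈ A s
  conjLinear : ∀ s ∈ O, ∀ (c : ℂ) ξ, α s (c • ξ) = (starRingEnd ℂ) c • α s ξ

/-- The decomposition `L ⊗ C^∞ = ⊕_p U^p`, together with the flat connection, is an (unpolarized)
complex variation of Hodge structure: the `U^p` are smooth subbundles, their direct sum is
everything, and `∇` maps sections of `U^p` over any open set into
`𝓔^{0,1}(U^{p+1}) ⊕ 𝓔^{0,1}(U^p) ⊕ 𝓔^{1,0}(U^p) ⊕ 𝓔^{1,0}(U^{p-1})`. -/
structure IsComplexVHS (L : LocalSystem.{u, v, 0} ℂ S)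
    (U : ℤ → ∀ s, Submodule ℂ (L.fiber s)) : Prop where
  smooth : ∀ p, L.IsSmoothSubbundle E (U p)
  isInternal : ∀ s, DirectSum.IsInternal fun p => U p s
  horizontal : ∀ (p : ℤ) (O : Set S), IsOpen O → ∀ σ : ∀ s, L.fiber s,
    (∀ s ∈ O, L.SmoothAt E σ s ∧ σ s ∈ U p s) →
    ∃ τ β γ θ : ∀ s : S, E →ₗ[ℝ] L.fiber s,
      L.IsForm01 E O (U (p + 1)) τ ∧ L.IsForm01 E O (U p) β ∧
      L.IsForm10 E O (U p) γ ∧ L.IsForm10 E O (U (p - 1)) θ ∧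
      ∀ s ∈ O, L.nabla E σ s = τ s + β s + γ s + θ s

end Analysis

end LocalSystem

/-! ## Hodge structures -/

namespace Hodge

variable {H : Type v} [AddCommGroup H] [Module ℚ H]

variable (H) in
/-- Complex conjugation of `ℂ ⊗ H` with respect to `H`. -/
def conj : (ℂ ⊗[ℚ] H) →ₛₗ[starRingEnd ℂ] (ℂ ⊗[ℚ] H) where
  toFun := TensorProduct.map (((starRingEnd ℂ : ℂ →+* ℂ) : ℂ →+ ℂ).toRatLinearMap) LinearMap.id
  map_add' := map_add _
  map_smul' c z := by
    induction z with
    | zero => simp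
    | add a b ha hb => rw [smul_add, map_add, map_add, smul_add, ha, hb]
    | tmul a b => simp [TensorProduct.smul_tmul']

/-- The complex conjugate of a subspace. -/
def conjSub (A : Submodule ℂ (ℂ ⊗[ℚ] H)) : Submodule ℂ (ℂ ⊗[ℚ] H) := A.map (conj H)

/-- The decreasing filtration `F` is a pure Hodge structure of weight `k`. -/
structure IsPure (k : ℤ) (F : ℤ → Submodule ℂ (ℂ ⊗[ℚ] H)) : Prop where
  antitone : Antitone F
  exists_eq_top : ∃ p, F p = ⊤
  exists_eq_bot : ∃ p, F p = ⊥
  isCompl : ∀ p, IsCompl (F p) (conjSub (F (k - p + 1)))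

/-- `Q` polarizes the pure Hodge structure `F` of weight `k`, whose Hodge components are
`H^{p,q} = F^p ∩ conj F^q`, `p + q = k`. -/
structure IsPolarization (k : ℤ) (F : ℤ → Submodule ℂ (ℂ ⊗[ℚ] H))
    (Q : LinearMap.BilinForm ℚ H) : Prop where
  parity : ∀ u v, Q u v = (-1 : ℚ) ^ k * Q v u
  nondegenerate : Q.Nondegenerate
  orthogonal : ∀ p, ∀ u ∈ F p, ∀ v ∈ F (k - p + 1), Q.baseChange ℂ u v = 0
  positive : ∀ p q, p + q = k → ∀ u ∈ F p ⊓ conjSub (F q), u ≠ 0 →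
    ∃ r : ℝ, 0 < r ∧ Complex.I ^ (p - q) * Q.baseChange ℂ u (conj H u) = r

/-- The filtration induced by `F` on the complexification of `A/(A ∩ B)`; for `A = W_k`,
`B = W_{k-1}` this is `F^p Gr^W_k = (F^p ∩ W_k + W_{k-1})/W_{k-1}`. -/
def inducedFiltration (F : Submodule ℂ (ℂ ⊗[ℚ] H)) (A B : Submodule ℚ H) :
    Submodule ℂ (ℂ ⊗[ℚ] (A ⧸ B.submoduleOf A)) :=
  (F.comap (A.subtype.baseChange ℂ)).map ((B.submoduleOf A).mkQ.baseChange ℂ)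

/-- `I` is the Deligne bigrading of the mixed Hodge structure `(F, W)`: `ℂ ⊗ H = ⊕ I^{p,q}`,
`F^p = ⊕_{r ≥ p} I^{r,s}`, `W_k ⊗ ℂ = ⊕_{r + s ≤ k} I^{r,s}`, and
`I^{p,q} = conj I^{q,p} mod ⊕_{r < p, s < q} I^{r,s}`. -/
structure IsDeligneBigrading (F : ℤ → Submodule ℂ (ℂ ⊗[ℚ] H)) (W : ℤ → Submodule ℚ H)
    (I : ℤ → ℤ → Submodule ℂ (ℂ ⊗[ℚ] H)) : Prop where
  isInternal : DirectSum.IsInternal fun pq : ℤ × ℤ => I pq.1 pq.2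
  hodge_eq : ∀ p, F p = ⨆ (r : ℤ) (s : ℤ) (_ : p ≤ r), I r s
  weight_eq : ∀ k, (W k).baseChange ℂ = ⨆ (r : ℤ) (s : ℤ) (_ : r + s ≤ k), I r s
  conj_eq : ∀ p q,
    I p q ⊔ (⨆ (r : ℤ) (s : ℤ) (_ : r < p ∧ s < q), I r s) =
      conjSub (I q p) ⊔ ⨆ (r : ℤ) (s : ℤ) (_ : r < p ∧ s < q), I r s

end Hodge

/-! ## Variations of Hodge structure -/

section Variations

variable (E : Type w) [NormedAddCommGroup E] [NormedSpace ℂ E]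
  {S : Type u} [TopologicalSpace S] [ChartedSpace E S]

/-- `(H, F, Q)` is a variation of pure polarized Hodge structure of weight `k`. -/
structure IsPolarizedVHS (H : LocalSystem.{u, v, 0} ℚ S) (k : ℤ)
    (F : ℤ → ∀ s, Submodule ℂ (ℂ ⊗[ℚ] H.fiber s))
    (Q : ∀ s, LinearMap.BilinForm ℚ (H.fiber s)) : Prop where
  holomorphic : ∀ p, H.complexify.IsHolomorphicSubbundle E (F p)
  transversal : H.complexify.IsTransversal E F
  flat : ∀ x, ∀ᶠ s in 𝓝 x, ∀ u v, Q x (H.transport x s u) (H.transport x s v) = Q s u v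
  pure : ∀ s, Hodge.IsPure k fun p => F p s
  polarized : ∀ s, Hodge.IsPolarization k (fun p => F p s) (Q s)

variable (S) in
/-- A variation of graded-polarized mixed Hodge structure on the complex manifold `S`. -/
structure VGPMHS where
  /-- The underlying rational local system. -/
  VQ : LocalSystem.{u, v, 0} ℚ S
  /-- The weight filtration: finite, increasing, by rational local subsystems. -/
  W : ℤ → ∀ s, Submodule ℚ (VQ.fiber s)
  W_flat : ∀ k, VQ.IsFlatSub (W k)
  W_mono : ∀ s, Monotone fun k => W k s
  W_exists_eq_bot : ∀ s, ∃ k, W k s = ⊥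
  W_exists_eq_top : ∀ s, ∃ k, W k s = ⊤
  /-- The Hodge filtration: finite, decreasing, by holomorphic subbundles. -/
  F : ℤ → ∀ s, Submodule ℂ (ℂ ⊗[ℚ] VQ.fiber s)
  F_holomorphic : ∀ p, VQ.complexify.IsHolomorphicSubbundle E (F p)
  F_anti : ∀ s, Antitone fun p => F p s
  F_exists_eq_top : ∀ s, ∃ p, F p s = ⊤
  F_exists_eq_bot : ∀ s, ∃ p, F p s = ⊥
  F_transversal : VQ.complexify.IsTransversal E F
  /-- The rational bilinear forms on the graded pieces `W_k / W_{k-1}`. -/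
  Q : ∀ k s, LinearMap.BilinForm ℚ (W k s ⧸ (W (k - 1) s).submoduleOf (W k s))
  graded : ∀ k, IsPolarizedVHS E
    (VQ.subquotient (W k) (W (k - 1)) (W_flat k) (W_flat (k - 1))) k
    (fun p s => Hodge.inducedFiltration (F p s) (W k s) (W (k - 1) s)) (Q k)

end Variations

end

/-! Write G^q for the sum of all I^{r,t} with r ≤ q (`opposed` below). The proof rests on two
identities: U^p = F^p ∩ G^p, and F^p ⊕ G^{p-1} is the whole fibre. It therefore suffices to
understand the two filtrations F and G separately; U^p itself is neither holomorphic nor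
antiholomorphic in general.

Pointwise existence and uniqueness of the bigrading are pure lattice theory, for subspaces with
conjugation as an order automorphism. Any bigrading satisfies Deligne's recursion I^{p,q} = F^p ∩
W_{p+q} ∩ (conj F^q ∩ W_{p+q} + Σ_{r<p, t<q} I^{r,t}) (`IsBigrading.eq`). The right side involves
only lower weights, so uniqueness follows by induction. Conversely, the recursion defines the
components weight by weight, and the opposedness of F and conj F on Gr^W_k shows that each extension
works (`IsMixedHodge.extend`).

The index set r ≤ q is closed under passing to strictly smaller indices, so the error terms in the
conjugation symmetry are absorbed and G^q is exactly the conjugate of the sum of the I^{r,t} with t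
≤ q. Consequently conj(F^a ∩ W_k) lies in G^q whenever k ≤ q + a (`IsBigrading.conj_hodge_inf_le`).
The ranks of F^p ∩ W_k are locally constant because the graded pieces are holomorphic subbundles, so
a basis of the I^{p,q} at one point extends to holomorphic sections of F^p ∩ W_{p+q}
(`exists_holomorphic_extension`, `exists_adaptedFrame`). Suitable members of this frame span F^p
nearby, and conjugates of suitable members span G^q nearby. Hence the projections attached to F and
G are smooth.

Horizontality: for a section of F^p, ∇ takes values in F^{p-1} and its (0,1)-part lies in F^p.
Griffiths transversality lowers the Hodge index by one and flatness of W keeps the weight. After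
conjugation, ∇ therefore maps sections of G^p into G^{p+1}, with (1,0)-part in G^p. For a section of
U^p, the (0,1)-part of ∇ lies in F^p ∩ G^{p+1} = U^p ⊕ U^{p+1} and the (1,0)-part in F^{p-1} ∩ G^p =
U^{p-1} ⊕ U^p. -/

noncomputable section

/-! ## Bigradings in modular lattices -/

section Lattice

variable {α : Type*} [CompleteLattice α]

/-- The supremum of a family over a set of indices. -/
def supOver {ι : Type*} (I : ι → α) (Λ : Set ι) : α := ⨆ i ∈ Λ, I i

section SupOver

variable {ι : Type*} {I J : ι → α} {Λ Λ' : Set ι}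

theorem le_supOver {i : ι} (hi : i ∈ Λ) : I i ≤ supOver I Λ := le_iSup₂_of_le i hi le_rfl

theorem supOver_le {a : α} (h : ∀ i ∈ Λ, I i ≤ a) : supOver I Λ ≤ a := iSup₂_le h

theorem supOver_mono (h : Λ ⊆ Λ') : supOver I Λ ≤ supOver I Λ' :=
  supOver_le fun _ hi => le_supOver (h hi)

theorem supOver_congr (h : ∀ i ∈ Λ, I i = J i) : supOver I Λ = supOver J Λ :=
  iSup_congr fun i => iSup_congr fun hi => h i hi

theorem supOver_union : supOver I (Λ ∪ Λ') = supOver I Λ ⊔ supOver I Λ' := iSup_union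

/-- Independence makes the part indexed by Λ \ Λ' disjoint from the sum over Λ', and the modular law
then discards it. With this lemma, intersections of subspaces become intersections of index sets. -/
theorem supOver_inter [IsModularLattice α] [IsCompactlyGenerated α] (hI : iSupIndep I) :
    supOver I Λ ⊓ supOver I Λ' = supOver I (Λ ∩ Λ') := by
  refine le_antisymm ?_ (le_inf (supOver_mono Set.inter_subset_left)
    (supOver_mono Set.inter_subset_right))
  have hd : supOver I (Λ \ Λ') ⊓ supOver I Λ' = ⊥ :=
    (hI.disjoint_biSup_biSup disjoint_sdiff_self_left).eq_bot
  calc supOver I Λ ⊓ supOver I Λ'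
      = (supOver I (Λ ∩ Λ') ⊔ supOver I (Λ \ Λ')) ⊓ supOver I Λ' := by
        rw [← supOver_union, Set.inter_union_sdiff]
    _ = supOver I (Λ ∩ Λ') := by
        rw [sup_inf_assoc_of_le _ (supOver_mono Set.inter_subset_right), hd, sup_bot_eq]
    _ ≤ _ := le_rfl

theorem map_supOver (κ : α ≃o α) : κ (supOver I Λ) = supOver (fun i => κ (I i)) Λ := by
  simp [supOver]

end SupOver

/-- A family indexed by a set mapping to a linear order is independent if each member is disjoint
from the supremum of the smaller ones. -/
theorem iSupIndep_of_disjoint_lt [IsModularLattice α] [IsCompactlyGenerated α] {ι β : Type*}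
    [LinearOrder β] (f : ι → β) (hf : Function.Injective f) (I : ι → α)
    (h : ∀ i, Disjoint (I i) (supOver I {j | f j < f i})) : iSupIndep I := by
  classical
  refine iSupIndep_iff_supIndep.2 fun s => ?_
  induction s using Finset.induction_on_max_value f with
  | empty => exact Finset.supIndep_empty _
  | insert a s ha hmax ih =>
    have hs : s.sup I ≤ supOver I {j | f j < f a} := Finset.sup_le fun j hj =>
      le_supOver ((hmax j hj).lt_of_ne fun e => ha (hf e ▸ hj))
    have hd := (h a).mono_right hs
    rw [Finset.supIndep_iff_disjoint_erase] at ih ⊢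
    intro i hi
    rcases Finset.mem_insert.1 hi with rfl | hi
    · rwa [Finset.erase_insert ha]
    · have hia : a ≠ i := fun e => ha (e ▸ hi)
      rw [Finset.erase_insert_of_ne hia, Finset.sup_insert, sup_comm]
      refine (ih i hi).disjoint_sup_right_of_disjoint_sup_left ?_
      rw [← Finset.sup_insert, Finset.insert_erase hi]
      exact hd.symm

/-- The indices which are strictly smaller in both coordinates. -/
def strictlyBelow (i : ℤ × ℤ) : Set (ℤ × ℤ) := {j | j.1 < i.1 ∧ j.2 < i.2}

/-- `I` is a bigrading of the filtrations `F` and `W`, symmetric under `κ` up to lower terms. -/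
structure IsBigrading (κ : α ≃o α) (F W : ℤ → α) (I : ℤ × ℤ → α) : Prop where
  indep : iSupIndep I
  hodge : ∀ p, F p = supOver I {i | p ≤ i.1}
  weight : ∀ k, W k = supOver I {i | i.1 + i.2 ≤ k}
  conj : ∀ i, I i ⊔ supOver I (strictlyBelow i) = κ (I i.swap) ⊔ supOver I (strictlyBelow i)

/-- Sums over sets of indices closed under passing to strictly smaller indices are compatible with
the symmetry. -/
theorem supOver_conj {κ : α ≃o α} {I : ℤ × ℤ → α}
    (hc : ∀ i, I i ⊔ supOver I (strictlyBelow i) =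
      κ (I i.swap) ⊔ supOver I (strictlyBelow i))
    {m : ℤ} (hm : ∀ i, i.1 + i.2 ≤ m → I i = ⊥) {Λ : Set (ℤ × ℤ)}
    (hΛ : ∀ i ∈ Λ, strictlyBelow i ⊆ Λ) :
    supOver I Λ = supOver (fun i : ℤ × ℤ => κ (I i.swap)) Λ := by
  apply le_antisymm
  -- Induction on the weight: the correction terms in `hc` have smaller weight and stay inside Λ.
  · have key : ∀ n : ℕ, ∀ i ∈ Λ, i.1 + i.2 ≤ m + n →
        I i ≤ supOver (fun i : ℤ × ℤ => κ (I i.swap)) Λ := by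
      intro n
      induction n with
      | zero => intro i _ h; rw [hm i (by simpa using h)]; exact bot_le
      | succ n ih =>
        intro i hi h
        refine le_sup_left.trans ((hc i).le.trans (sup_le (le_supOver (I := fun i => κ (I i.swap)) hi)
          (supOver_le fun j hj => ih j (hΛ i hi hj) ?_)))
        have h1 := hj.1
        have h2 := hj.2
        push_cast at h
        omega
    refine supOver_le fun i hi => key (i.1 + i.2 - m).toNat i hi ?_
    omega
  · exact supOver_le fun i hi => le_sup_left.trans ((hc i).ge.trans
      (sup_le (le_supOver hi) (supOver_mono (hΛ i hi))))

theorem supOver_swap {I : ℤ × ℤ → α} {Λ : Set (ℤ × ℤ)} :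
    supOver (fun i : ℤ × ℤ => I i.swap) Λ = supOver I {i | i.swap ∈ Λ} := by
  apply le_antisymm
  · exact supOver_le fun i hi => le_supOver (I := I) (i := i.swap) (by simpa using hi)
  · exact supOver_le fun i hi =>
      le_supOver (I := fun i : ℤ × ℤ => I i.swap) (Λ := Λ) (i := i.swap) hi

theorem map_supOver_swap (κ : α ≃o α) {I : ℤ × ℤ → α} {Λ : Set (ℤ × ℤ)} :
    κ (supOver I Λ) = supOver (fun i : ℤ × ℤ => κ (I i.swap)) {i | i.swap ∈ Λ} := by
  rw [map_supOver, supOver_swap (I := fun i => κ (I i))]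
  simp

section Modular

variable [IsModularLattice α]

/-- The recursive description of the components of a bigrading. -/
theorem IsBigrading.eq [IsCompactlyGenerated α] {κ : α ≃o α} {F W : ℤ → α} {I : ℤ × ℤ → α}
    (h : IsBigrading κ F W I) {m : ℤ} (hm : W m = ⊥) (hW : ∀ k, κ (W k) = W k) (i : ℤ × ℤ) :
    I i = F i.1 ⊓ W (i.1 + i.2) ⊓
      (κ (F i.2) ⊓ W (i.1 + i.2) ⊔ supOver I (strictlyBelow i)) := by
  obtain ⟨p, q⟩ := i
  have hbot : ∀ i : ℤ × ℤ, i.1 + i.2 ≤ m → I i = ⊥ := fun i hi =>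
    le_bot_iff.1 ((le_supOver (Λ := {i : ℤ × ℤ | i.1 + i.2 ≤ m}) hi).trans
      ((h.weight m).ge.trans hm.le))
  have h1 : κ (F q) ⊓ W (p + q) =
      supOver (fun i : ℤ × ℤ => κ (I i.swap)) {i | q ≤ i.2 ∧ i.1 + i.2 ≤ p + q} := by
    rw [← hW, ← OrderIso.map_inf, h.hodge, h.weight, supOver_inter h.indep, map_supOver_swap]
    congr 1
    ext j
    simp [add_comm j.2]
  have hlow : ∀ i ∈ strictlyBelow (p, q), strictlyBelow i ⊆ strictlyBelow (p, q) :=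
    fun i hi j hj => ⟨hj.1.trans hi.1, hj.2.trans hi.2⟩
  have h2 : κ (F q) ⊓ W (p + q) ⊔ supOver I (strictlyBelow (p, q)) =
      supOver I ({i | q ≤ i.2 ∧ i.1 + i.2 ≤ p + q} ∪ strictlyBelow (p, q)) := by
    rw [supOver_conj h.conj hbot (Λ := _ ∪ _), h1, supOver_union,
      ← supOver_conj h.conj hbot hlow]
    -- An index strictly below one with second entry ≥ q and weight ≤ p + q either still has second
    -- entry ≥ q, or has second entry < q and first entry < p.
    rintro i hi j ⟨hj1, hj2⟩
    simp only [strictlyBelow, Set.mem_union, Set.mem_ofPred_eq] at hi ⊢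
    omega
  dsimp only
  rw [h2, h.hodge, h.weight, supOver_inter h.indep, supOver_inter h.indep]
  -- The condition p ≤ r rules out the strictly lower indices; then q ≤ t and r + t ≤ p + q leave a
  -- single index.
  have : ({i : ℤ × ℤ | p ≤ i.1} ∩ {i | i.1 + i.2 ≤ p + q} ∩
      ({i | q ≤ i.2 ∧ i.1 + i.2 ≤ p + q} ∪ strictlyBelow (p, q))) = {(p, q)} := by
    ext ⟨r, s⟩
    simp only [strictlyBelow, Set.mem_union, Set.mem_inter_iff, Set.mem_ofPred_eq,
      Set.mem_singleton_iff, Prod.mk.injEq]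
    omega
  rw [this]
  simp [supOver]

/-- The recursion `IsBigrading.eq` expresses a component through F, W and components of smaller
weight, so induction on the weight applies. -/
theorem IsBigrading.unique [IsCompactlyGenerated α] {κ : α ≃o α} {F W : ℤ → α} {I J : ℤ × ℤ → α}
    (hI : IsBigrading κ F W I) (hJ : IsBigrading κ F W J) {m : ℤ} (hm : W m = ⊥)
    (hW : ∀ k, κ (W k) = W k) : I = J := by
  have hbot : ∀ {I : ℤ × ℤ → α}, IsBigrading κ F W I → ∀ i : ℤ × ℤ, i.1 + i.2 ≤ m → I i = ⊥ :=
    fun h i hi => le_bot_iff.1 ((le_supOver (Λ := {i : ℤ × ℤ | i.1 + i.2 ≤ m}) hi).trans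
      ((h.weight m).ge.trans hm.le))
  have key : ∀ n : ℕ, ∀ i : ℤ × ℤ, i.1 + i.2 ≤ m + n → I i = J i := by
    intro n
    induction n with
    | zero =>
      intro i hi
      rw [hbot hI i (by simpa using hi), hbot hJ i (by simpa using hi)]
    | succ n ih =>
      intro i hi
      rw [hI.eq hm hW, hJ.eq hm hW]
      congr 2
      refine supOver_congr fun j hj => ih j ?_
      have h1 := hj.1
      have h2 := hj.2
      push_cast at hi
      omega
  funext i
  exact key (i.1 + i.2 - m).toNat i (by omega)

/-- `I` is a bigrading of the restrictions of `F` and `W` to `W k`. -/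
structure IsBigradingUpTo (κ : α ≃o α) (F W : ℤ → α) (k : ℤ) (I : ℤ × ℤ → α) : Prop where
  disj : ∀ i, Disjoint (I i)
    (supOver I {j | j.1 + j.2 < i.1 + i.2 ∨ j.1 + j.2 = i.1 + i.2 ∧ i.1 < j.1})
  bot : ∀ i : ℤ × ℤ, k < i.1 + i.2 → I i = ⊥
  weight : ∀ j ≤ k, W j = supOver I {i | i.1 + i.2 ≤ j}
  hodge : ∀ p, F p ⊓ W k = supOver I {i | p ≤ i.1 ∧ i.1 + i.2 ≤ k}
  conj : ∀ i, I i ⊔ supOver I (strictlyBelow i) = κ (I i.swap) ⊔ supOver I (strictlyBelow i)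

theorem IsBigradingUpTo.indep [IsCompactlyGenerated α] {κ : α ≃o α} {F W : ℤ → α} {k : ℤ}
    {I : ℤ × ℤ → α} (h : IsBigradingUpTo κ F W k I) : iSupIndep I := by
  -- The order is by weight, then by decreasing first index. This is how the components build up W,
  -- and within one weight the filtration F.
  refine iSupIndep_of_disjoint_lt (fun i => toLex (i.1 + i.2, -i.1)) (fun i j hij => ?_) I
    fun i => ?_
  · have := toLex.injective hij
    simp only [Prod.mk.injEq] at this
    ext <;> omega
  · convert h.disj i using 4
    simp only [Prod.Lex.toLex_lt_toLex]
    omega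

/-- The data of a mixed Hodge structure in a modular lattice: a weight filtration stable under `κ`,
and a Hodge filtration inducing opposed filtrations on each `[W (k - 1), W k]`. -/
structure IsMixedHodge (κ : α ≃o α) (F W : ℤ → α) : Prop where
  invol : ∀ a, κ (κ a) = a
  conj_weight : ∀ k, κ (W k) = W k
  mono : Monotone W
  anti : Antitone F
  weight_bot : ∃ k, W k = ⊥
  weight_top : ∃ k, W k = ⊤
  hodge_bot : ∃ k, F k = ⊥
  hodge_top : ∃ k, F k = ⊤
  inf_le : ∀ k p, (F p ⊓ W k ⊔ W (k - 1)) ⊓ (κ (F (k - p + 1)) ⊓ W k ⊔ W (k - 1)) ≤ W (k - 1)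
  le_sup : ∀ k p, W k ≤ (F p ⊓ W k ⊔ W (k - 1)) ⊔ (κ (F (k - p + 1)) ⊓ W k ⊔ W (k - 1))

/-- Extension of a bigrading to the next step of the weight filtration. -/
def extendBigrading (κ : α ≃o α) (F W : ℤ → α) (k : ℤ) (I : ℤ × ℤ → α) : ℤ × ℤ → α := fun i =>
  if i.1 + i.2 = k then
    F i.1 ⊓ W k ⊓ (κ (F i.2) ⊓ W k ⊔ supOver I (strictlyBelow i))
  else I i

/-- Modulo W_{k-1}, the new component I'^{p,q} is F^p ∩ conj F^q: `new_disj` gives injectivity and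
`new_sup` gives the image. Opposedness then makes I'^{p,q} a complement of F^{p+1} in F^p modulo
W_{k-1} (`step_disj`, `step_sup`), and descending induction on p recovers the whole induced
filtration (`hA`). -/
theorem IsMixedHodge.extend [IsCompactlyGenerated α] {κ : α ≃o α} {F W : ℤ → α}
    (h : IsMixedHodge κ F W) {k : ℤ} {I : ℤ × ℤ → α} (hI : IsBigradingUpTo κ F W (k - 1) I) :
    IsBigradingUpTo κ F W k (extendBigrading κ F W k I) := by
  set I' := extendBigrading κ F W k I with hI'
  have new : ∀ i : ℤ × ℤ, i.1 + i.2 = k → I' i =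
      F i.1 ⊓ W k ⊓ (κ (F i.2) ⊓ W k ⊔ supOver I (strictlyBelow i)) := fun i hi => by
    rw [hI', extendBigrading, if_pos hi]
  have old : ∀ i : ℤ × ℤ, i.1 + i.2 ≠ k → I' i = I i := fun i hi => by
    rw [hI', extendBigrading, if_neg hi]
  have oldS : ∀ Λ : Set (ℤ × ℤ), (∀ i ∈ Λ, i.1 + i.2 ≤ k - 1) → supOver I' Λ = supOver I Λ :=
    fun Λ hΛ => supOver_congr fun i hi => old i (by have := hΛ i hi; omega)
  have hind := hI.indep
  obtain ⟨m₀, hm₀⟩ := h.weight_bot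
  obtain ⟨m, hmk, hm⟩ : ∃ m, m ≤ k - 1 ∧ W m = ⊥ :=
    ⟨min m₀ (k - 1), min_le_right _ _, le_bot_iff.1 ((h.mono (min_le_left _ _)).trans hm₀.le)⟩
  have hbot : ∀ i : ℤ × ℤ, i.1 + i.2 ≤ m → I i = ⊥ := fun i hi =>
    le_bot_iff.1 ((le_supOver (Λ := {i : ℤ × ℤ | i.1 + i.2 ≤ m}) hi).trans
      ((hI.weight m hmk).ge.trans hm.le))
  have hww : W (k - 1) ≤ W k := h.mono (by omega)
  have belowW : ∀ i : ℤ × ℤ, i.1 + i.2 = k → supOver I (strictlyBelow i) ≤ W (k - 1) := by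
    intro i hi
    rw [hI.weight _ le_rfl]
    refine supOver_mono fun j hj => ?_
    have h1 := hj.1
    have h2 := hj.2
    simp only [Set.mem_ofPred_eq]
    omega
  have hlow : ∀ (i : ℤ × ℤ), ∀ j ∈ strictlyBelow i, strictlyBelow j ⊆ strictlyBelow i :=
    fun i j hi l hj => ⟨hj.1.trans hi.1, hj.2.trans hi.2⟩
  -- the part of the conjugate filtration in lower weight
  have gw : ∀ i : ℤ × ℤ, i.1 + i.2 = k →
      κ (F i.2) ⊓ W k ⊓ W (k - 1) ⊔ supOver I (strictlyBelow i) =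
        supOver I ({j | i.2 ≤ j.2 ∧ j.1 + j.2 ≤ k - 1} ∪ strictlyBelow i) := by
    intro i hi
    have h1 : κ (F i.2) ⊓ W k ⊓ W (k - 1) =
        supOver (fun i : ℤ × ℤ => κ (I i.swap)) {j | i.2 ≤ j.2 ∧ j.1 + j.2 ≤ k - 1} := by
      rw [inf_assoc, inf_eq_right.2 hww, ← h.conj_weight, ← OrderIso.map_inf, hI.hodge, map_supOver_swap]
      congr 1
      ext j
      simp [add_comm j.2]
    rw [supOver_conj hI.conj hbot (Λ := _ ∪ _), h1, supOver_union,
      ← supOver_conj hI.conj hbot (hlow i)]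
    rintro a ha b ⟨hj1, hj2⟩
    simp only [strictlyBelow, Set.mem_union, Set.mem_ofPred_eq] at ha ⊢
    omega
  have fw : ∀ i : ℤ × ℤ, F i.1 ⊓ W k ⊓ W (k - 1) =
      supOver I {j | i.1 ≤ j.1 ∧ j.1 + j.2 ≤ k - 1} := by
    intro i
    rw [inf_assoc, inf_eq_right.2 hww, hI.hodge]
  have new_disj : ∀ i : ℤ × ℤ, i.1 + i.2 = k → I' i ⊓ W (k - 1) = ⊥ := by
    intro i hi
    have h1 : (κ (F i.2) ⊓ W k ⊔ supOver I (strictlyBelow i)) ⊓ W (k - 1) =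
        κ (F i.2) ⊓ W k ⊓ W (k - 1) ⊔ supOver I (strictlyBelow i) := by
      rw [sup_comm, sup_inf_assoc_of_le _ (belowW i hi), sup_comm]
    calc I' i ⊓ W (k - 1)
        = (F i.1 ⊓ W k ⊓ W (k - 1)) ⊓
          ((κ (F i.2) ⊓ W k ⊔ supOver I (strictlyBelow i)) ⊓ W (k - 1)) := by
          rw [new i hi, ← inf_inf_distrib_right]
      _ = supOver I ∅ := by
          -- No index survives: r ≥ p excludes strictly lower indices, and r ≥ p with t ≥ q
          -- contradicts weight ≤ k - 1.
          rw [h1, gw i hi, fw i, supOver_inter hind]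
          congr 1
          ext j
          simp only [strictlyBelow, Set.mem_union, Set.mem_inter_iff, Set.mem_ofPred_eq,
            Set.mem_empty_iff_false, iff_false]
          omega
      _ = ⊥ := by simp [supOver]
  have cover : ∀ i : ℤ × ℤ, i.1 + i.2 = k →
      κ (F i.2) ⊓ W k ⊔ W (k - 1) =
        (F i.1 ⊓ W k ⊓ W (k - 1)) ⊔ (κ (F i.2) ⊓ W k ⊔ supOver I (strictlyBelow i)) := by
    intro i hi
    apply le_antisymm
    · refine sup_le (le_sup_left.trans le_sup_right) ?_
      -- Every index of weight ≤ k - 1 has r ≥ p, or t ≥ q, or is strictly below (p, q).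
      have : W (k - 1) ≤ (F i.1 ⊓ W k ⊓ W (k - 1)) ⊔
          (κ (F i.2) ⊓ W k ⊓ W (k - 1) ⊔ supOver I (strictlyBelow i)) := by
        rw [gw i hi, fw, ← supOver_union, hI.weight _ le_rfl]
        refine supOver_mono fun j hj => ?_
        simp only [strictlyBelow, Set.mem_union, Set.mem_ofPred_eq] at hj ⊢
        omega
      exact this.trans (sup_le_sup le_rfl (sup_le_sup inf_le_left le_rfl))
    · exact sup_le (inf_le_right.trans le_sup_right)
        (sup_le le_sup_left ((belowW i hi).trans le_sup_right))
  have new_sup : ∀ i : ℤ × ℤ, i.1 + i.2 = k →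
      (F i.1 ⊓ W k ⊔ W (k - 1)) ⊓ (κ (F i.2) ⊓ W k ⊔ W (k - 1)) = I' i ⊔ W (k - 1) := by
    intro i hi
    have h1 : (F i.1 ⊓ W k) ⊓ (κ (F i.2) ⊓ W k ⊔ W (k - 1)) =
        F i.1 ⊓ W k ⊓ W (k - 1) ⊔ I' i := by
      rw [cover i hi, new i hi, inf_comm (F i.1 ⊓ W k) (_ ⊔ _),
        sup_inf_assoc_of_le _ inf_le_left, inf_comm (F i.1 ⊓ W k) (_ ⊔ _)]
    rw [sup_comm (F i.1 ⊓ W k), sup_inf_assoc_of_le _ le_sup_right, h1, ← sup_assoc,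
      sup_eq_left.2 (inf_le_right : F i.1 ⊓ W k ⊓ W (k - 1) ≤ _), sup_comm]
  have step_disj : ∀ i : ℤ × ℤ, i.1 + i.2 = k →
      I' i ⊓ (F (i.1 + 1) ⊓ W k ⊔ W (k - 1)) = ⊥ := by
    intro i hi
    have h1 : I' i ≤ κ (F i.2) ⊓ W k ⊔ W (k - 1) := by
      rw [new i hi]
      exact inf_le_right.trans (sup_le_sup le_rfl (belowW i hi))
    -- F^{p+1} and conj F^q are opposed in weight k because (p + 1) + q = k + 1.
    have h2 := h.inf_le k (i.1 + 1)
    rw [show k - (i.1 + 1) + 1 = i.2 by omega] at h2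
    refine le_bot_iff.1 ((new_disj i hi).le.trans' (le_inf inf_le_left ?_))
    exact (le_inf inf_le_right (inf_le_left.trans h1)).trans h2
  have step_sup : ∀ i : ℤ × ℤ, i.1 + i.2 = k →
      F i.1 ⊓ W k ⊔ W (k - 1) = (F (i.1 + 1) ⊓ W k ⊔ W (k - 1)) ⊔ I' i := by
    intro i hi
    have h2 := h.le_sup k (i.1 + 1)
    rw [show k - (i.1 + 1) + 1 = i.2 by omega] at h2
    have h3 : F (i.1 + 1) ⊓ W k ⊔ W (k - 1) ≤ F i.1 ⊓ W k ⊔ W (k - 1) :=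
      sup_le_sup (inf_le_inf (h.anti (by omega)) le_rfl) le_rfl
    have h4 : F i.1 ⊓ W k ⊔ W (k - 1) ≤ W k := sup_le inf_le_right hww
    rw [← inf_eq_left.2 (h4.trans h2), inf_comm, sup_inf_assoc_of_le _ h3, inf_comm (_ ⊔ _),
      new_sup i hi, sup_comm (I' i), ← sup_assoc,
      sup_eq_left.2 (le_sup_right : W (k - 1) ≤ F (i.1 + 1) ⊓ W k ⊔ W (k - 1))]
  -- the filtration induced by `F` on `[W (k - 1), W k]`
  have hA : ∀ p, F p ⊓ W k ⊔ W (k - 1) =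
      supOver I' {j | j.1 + j.2 ≤ k - 1 ∨ j.1 + j.2 = k ∧ p ≤ j.1} := by
    obtain ⟨a, ha⟩ := h.hodge_bot
    have hFbot : ∀ p, a ≤ p → F p = ⊥ := fun p hp => le_bot_iff.1 ((h.anti hp).trans ha.le)
    have base : ∀ p, a ≤ p → F p ⊓ W k ⊔ W (k - 1) =
        supOver I' {j | j.1 + j.2 ≤ k - 1 ∨ j.1 + j.2 = k ∧ p ≤ j.1} := by
      intro p hp
      rw [hFbot p hp, bot_inf_eq, bot_sup_eq, hI.weight _ le_rfl]
      apply le_antisymm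
      · rw [← oldS {i : ℤ × ℤ | i.1 + i.2 ≤ k - 1} fun i hi => hi]
        exact supOver_mono fun j hj => Or.inl hj
      · refine supOver_le fun j hj => ?_
        rcases hj with hj | ⟨hj, hpj⟩
        · rw [old j (by omega)]
          exact le_supOver (Λ := {i : ℤ × ℤ | i.1 + i.2 ≤ k - 1}) hj
        · rw [new j hj, hFbot j.1 (hp.trans hpj), bot_inf_eq, bot_inf_eq]
          exact bot_le
    intro p
    rcases le_total a p with hp | hp
    · exact base p hp
    -- Descent from a, where F vanishes; each step adjoins the single index (p - 1, k - (p - 1))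
    -- through `step_sup`.
    · induction p, hp using Int.leInductionDown with
      | base => exact base a le_rfl
      | pred p hp ih =>
        have := step_sup (p - 1, k - (p - 1)) (by simp)
        simp only [sub_add_cancel] at this
        rw [this, ih]
        have h1 : I' (p - 1, k - (p - 1)) = supOver I' {(p - 1, k - (p - 1))} := by
          simp [supOver]
        rw [h1, ← supOver_union]
        congr 1
        ext ⟨r, s⟩
        simp only [Set.mem_union, Set.mem_ofPred_eq, Set.mem_singleton_iff, Prod.mk.injEq]
        omega
  have hWk : W k = supOver I' {i | i.1 + i.2 ≤ k} := by
    apply le_antisymm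
    · obtain ⟨b, hb⟩ := h.hodge_top
      have := hA b
      rw [hb, top_inf_eq, sup_eq_left.2 hww] at this
      rw [this]
      refine supOver_mono fun j hj => ?_
      simp only [Set.mem_ofPred_eq] at hj ⊢
      omega
    · refine supOver_le fun i hi => ?_
      rcases (show i.1 + i.2 ≤ k from hi).eq_or_lt with hi | hi
      · rw [new i hi]
        exact inf_le_left.trans inf_le_right
      · rw [old i hi.ne]
        refine le_trans ?_ hww
        rw [hI.weight _ le_rfl]
        exact le_supOver (Λ := {i : ℤ × ℤ | i.1 + i.2 ≤ k - 1}) (by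
          simp only [Set.mem_ofPred_eq]; omega)
  refine ⟨fun i => ?_, fun i hi => ?_, fun j hj => ?_, fun p => ?_, fun i => ?_⟩
  · rcases lt_trichotomy (i.1 + i.2) k with hi | hi | hi
    · rw [old i hi.ne, oldS]
      · exact hI.disj i
      · rintro j (hj | hj) <;> omega
    · have := hA (i.1 + 1)
      rw [disjoint_iff]
      convert step_disj i hi
      rw [this]
      congr 1
      ext j
      simp only [Set.mem_ofPred_eq]
      omega
    · rw [old i hi.ne', hI.bot i (by omega)]
      exact disjoint_bot_left
  · rw [old i hi.ne', hI.bot i (by omega)]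
  · rcases hj.eq_or_lt with rfl | hj
    · exact hWk
    · rw [hI.weight j (by omega), oldS]
      intro i hi
      have : i.1 + i.2 ≤ j := hi
      omega
  · have hX : supOver I' {j | j.1 + j.2 = k ∧ p ≤ j.1} ≤ F p ⊓ W k := by
      refine supOver_le fun j hj => ?_
      rw [new j hj.1]
      exact inf_le_left.trans (inf_le_inf (h.anti hj.2) le_rfl)
    have hA' : F p ⊓ W k ⊔ W (k - 1) =
        supOver I' {j | j.1 + j.2 = k ∧ p ≤ j.1} ⊔ W (k - 1) := by
      rw [hA, hI.weight _ le_rfl, ← oldS {i : ℤ × ℤ | i.1 + i.2 ≤ k - 1} fun i hi => hi, ← supOver_union]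
      congr 1
      ext j
      simp only [Set.mem_union, Set.mem_ofPred_eq]
      omega
    -- The equality modulo W_{k-1} lifts by the modular law, because the new components already lie
    -- in F^p; the remainder is F^p ∩ W_{k-1}, known from the previous weight.
    have h1 : F p ⊓ W k = supOver I' {j | j.1 + j.2 = k ∧ p ≤ j.1} ⊔
        (F p ⊓ W k ⊓ W (k - 1)) := by
      conv_lhs => rw [← inf_eq_right.2 (le_sup_left : F p ⊓ W k ≤ F p ⊓ W k ⊔ W (k - 1)), hA',
        sup_inf_assoc_of_le _ hX, inf_comm (W (k - 1))]
    rw [h1, fw (p, 0), ← oldS {j : ℤ × ℤ | p ≤ j.1 ∧ j.1 + j.2 ≤ k - 1} fun i hi => hi.2, ← supOver_union]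
    congr 1
    ext j
    simp only [Set.mem_union, Set.mem_ofPred_eq]
    omega
  · rcases lt_trichotomy (i.1 + i.2) k with hi | hi | hi
    · have hs : i.swap.1 + i.swap.2 ≠ k := by simp only [Prod.fst_swap, Prod.snd_swap]; omega
      rw [old i hi.ne, old _ hs, oldS]
      · exact hI.conj i
      · rintro j ⟨h1, h2⟩
        omega
    · have hs : i.swap.1 + i.swap.2 = k := by simp only [Prod.fst_swap, Prod.snd_swap]; omega
      have hΛ : κ (supOver I (strictlyBelow i.swap)) = supOver I (strictlyBelow i) := by
        rw [supOver_conj hI.conj hbot (hlow i), map_supOver_swap]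
        congr 1
        ext j
        simp [strictlyBelow, and_comm]
      have e : supOver I' (strictlyBelow i) = supOver I (strictlyBelow i) :=
        oldS _ fun j ⟨h1, h2⟩ => by omega
      rw [e, new i hi, new _ hs]
      simp only [OrderIso.map_inf, OrderIso.map_sup, hΛ, h.invol, h.conj_weight, Prod.fst_swap, Prod.snd_swap]
      -- Let L be the sum over strictly lower indices. By the modular law both sides equal (F^p ∩
      -- W_k + L) ∩ (conj F^q ∩ W_k + L), which is visibly symmetric.
      rw [sup_comm, ← sup_inf_assoc_of_le _ le_sup_right, sup_comm (κ (F i.2) ⊓ W k ⊓ _),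
        ← sup_inf_assoc_of_le _ le_sup_right, sup_comm _ (F i.1 ⊓ W k),
        sup_comm _ (κ (F i.2) ⊓ W k), inf_comm]
    · have hs : i.swap.1 + i.swap.2 ≠ k := by simp only [Prod.fst_swap, Prod.snd_swap]; omega
      rw [old i hi.ne', old _ hs, hI.bot i (by omega), hI.bot i.swap (by
        simp only [Prod.fst_swap, Prod.snd_swap]; omega)]
      simp

/-- Existence of the bigrading of a mixed Hodge structure. -/
theorem IsMixedHodge.exists_isBigrading [IsCompactlyGenerated α] {κ : α ≃o α} {F W : ℤ → α}
    (h : IsMixedHodge κ F W) : ∃ I, IsBigrading κ F W I := by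
  obtain ⟨m, hm⟩ := h.weight_bot
  have key : ∀ n : ℕ, ∃ I, IsBigradingUpTo κ F W (m + n) I := by
    intro n
    induction n with
    | zero =>
      refine ⟨fun _ => ⊥, fun _ => disjoint_bot_left, fun _ _ => rfl, fun j hj => ?_, fun p => ?_,
        fun i => ?_⟩
      · simpa [supOver] using le_bot_iff.1 ((h.mono hj).trans (by simp [hm]))
      · simp [supOver, hm]
      · simp
    | succ n ih =>
      obtain ⟨I, hI⟩ := ih
      refine ⟨_, h.extend (k := m + (n + 1 : ℕ)) (I := I) ?_⟩
      convert hI using 1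
      push_cast
      ring
  obtain ⟨M₀, hM₀⟩ := h.weight_top
  obtain ⟨I, hI⟩ := key (M₀ - m).toNat
  set M := m + ((M₀ - m).toNat : ℤ) with hM
  have hMtop : W M = ⊤ := top_le_iff.1 (hM₀.ge.trans (h.mono (by omega)))
  refine ⟨I, hI.indep, fun p => ?_, fun k => ?_, hI.conj⟩
  · have := hI.hodge p
    rw [hMtop, inf_top_eq] at this
    rw [this]
    refine le_antisymm (supOver_mono fun i hi => hi.1) (supOver_le fun i hi => ?_)
    by_cases hiM : i.1 + i.2 ≤ M
    · exact le_supOver (Λ := {i : ℤ × ℤ | p ≤ i.1 ∧ i.1 + i.2 ≤ M}) ⟨hi, hiM⟩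
    · rw [hI.bot i (by omega)]
      exact bot_le
  · rcases le_total k M with hk | hk
    · exact hI.weight k hk
    · rw [top_le_iff.1 (hMtop.ge.trans (h.mono hk)), eq_comm, eq_top_iff, ← hMtop,
        hI.weight M le_rfl]
      exact supOver_mono fun i hi => le_trans hi hk

end Modular

end Lattice

/-! ### The increasing filtration opposed to the Hodge filtration. -/

section Lattice

variable {α : Type*} [CompleteLattice α] {κ : α ≃o α} {F W : ℤ → α} {I : ℤ × ℤ → α}

theorem IsBigrading.supOver_univ (h : IsBigrading κ F W I) {M : ℤ} (hM : W M = ⊤) :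
    supOver I Set.univ = ⊤ :=
  top_le_iff.1 (hM.ge.trans ((h.weight M).le.trans (supOver_mono (Set.subset_univ _))))

theorem IsBigrading.eq_bot (h : IsBigrading κ F W I) {m : ℤ} (hm : W m = ⊥) (i : ℤ × ℤ)
    (hi : i.1 + i.2 ≤ m) : I i = ⊥ :=
  le_bot_iff.1 ((le_supOver (Λ := {i : ℤ × ℤ | i.1 + i.2 ≤ m}) hi).trans
    ((h.weight m).ge.trans hm.le))

/-- Single components are conjugate only modulo lower terms. Here the equality is exact, because {i
| i.1 ≤ q} contains all indices strictly below its members. -/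
theorem IsBigrading.conj_snd_le (h : IsBigrading κ F W I) {m : ℤ} (hm : W m = ⊥) (q : ℤ) :
    κ (supOver I {i | i.2 ≤ q}) = supOver I {i | i.1 ≤ q} := by
  rw [supOver_conj h.conj (h.eq_bot hm) (Λ := {i | i.1 ≤ q}), map_supOver_swap]
  · rfl
  · intro i hi j hj
    exact hj.1.le.trans hi

theorem iSup_eq_supOver (p : ℤ) : ⨆ q, I (p, q) = supOver I {i | i.1 = p} := by
  apply le_antisymm
  · exact iSup_le fun q => le_supOver (Λ := {i : ℤ × ℤ | i.1 = p}) rfl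
  · refine supOver_le fun i hi => ?_
    obtain rfl : i.1 = p := hi
    exact le_iSup (fun q => I (i.1, q)) i.2

theorem iSup_iSup_eq_supOver (P : ℤ × ℤ → Prop) :
    ⨆ (r : ℤ) (s : ℤ) (_ : P (r, s)), I (r, s) = supOver I {i | P i} := by
  apply le_antisymm
  · exact iSup_le fun r => iSup_le fun s => iSup_le fun h => le_supOver (Λ := {i | P i}) h
  · exact supOver_le fun i hi => le_iSup_of_le i.1 (le_iSup_of_le i.2 (le_iSup_of_le hi le_rfl))

variable [IsModularLattice α] [IsCompactlyGenerated α]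

theorem IsBigrading.isCompl (h : IsBigrading κ F W I) {M : ℤ} (hM : W M = ⊤) {p q : ℤ}
    (hpq : q + 1 = p) : IsCompl (F p) (supOver I {i | i.1 ≤ q}) := by
  refine IsCompl.of_eq ?_ ?_
  · rw [h.hodge, supOver_inter h.indep]
    convert (show supOver I ∅ = ⊥ by simp [supOver])
    ext j
    simp only [Set.mem_inter_iff, Set.mem_ofPred_eq, Set.mem_empty_iff_false, iff_false]
    omega
  · rw [h.hodge, ← supOver_union, ← h.supOver_univ hM]
    congr 1
    ext j
    simp only [Set.mem_union, Set.mem_ofPred_eq, Set.mem_univ, iff_true]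
    omega

theorem IsBigrading.hodge_inf (h : IsBigrading κ F W I) (p q : ℤ) :
    F p ⊓ supOver I {i | i.1 ≤ q} = supOver I {i | p ≤ i.1 ∧ i.1 ≤ q} := by
  rw [h.hodge, supOver_inter h.indep]
  rfl

/-- Indices with r ≥ a and r + t ≤ k have t ≤ k - a ≤ q, so `conj_snd_le` applies. The weight bound
is what lets conjugates of Hodge classes control the opposed filtration. -/
theorem IsBigrading.conj_hodge_inf_le (h : IsBigrading κ F W I) {m : ℤ} (hm : W m = ⊥)
    (hW : ∀ k, κ (W k) = W k) {a k q : ℤ} (hk : k ≤ q + a) :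
    κ (F a) ⊓ W k ≤ supOver I {i | i.1 ≤ q} := by
  rw [← h.conj_snd_le hm, ← hW, ← OrderIso.map_inf, h.hodge, h.weight, supOver_inter h.indep]
  refine κ.monotone (supOver_mono fun i hi => ?_)
  have h1 : a ≤ i.1 := hi.1
  have h2 : i.1 + i.2 ≤ k := hi.2
  show i.2 ≤ q
  omega

theorem IsBigrading.iSupIndep_fst (h : IsBigrading κ F W I) :
    iSupIndep fun p => supOver I {i | i.1 = p} := by
  intro p
  have : ⨆ (q : ℤ) (_ : q ≠ p), supOver I {i | i.1 = q} ≤ supOver I {i | i.1 ≠ p} :=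
    iSup₂_le fun q hq => supOver_mono fun i hi => fun e => hq (by rw [← e]; exact hi.symm)
  refine (h.indep.disjoint_biSup_biSup ?_).mono_right this
  rw [Set.disjoint_left]
  intro i hi hi'
  exact hi' hi

end Lattice

/-! ## The bigrading of a mixed Hodge structure -/

namespace Hodge

variable {H : Type v} [AddCommGroup H] [Module ℚ H]

@[simp] theorem conj_tmul (a : ℂ) (x : H) :
    conj H (a ⊗ₜ[ℚ] x) = (starRingEnd ℂ a) ⊗ₜ[ℚ] x := rfl

@[simp] theorem conj_conj (z : ℂ ⊗[ℚ] H) : conj H (conj H z) = z := by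
  induction z with
  | zero => simp
  | add a b ha hb => rw [map_add, map_add, ha, hb]
  | tmul a b => simp

theorem conj_baseChange {H' : Type*} [AddCommGroup H'] [Module ℚ H'] (f : H →ₗ[ℚ] H')
    (z : ℂ ⊗[ℚ] H) : conj H' (f.baseChange ℂ z) = f.baseChange ℂ (conj H z) := by
  induction z with
  | zero => simp
  | add a b ha hb => simp only [map_add, ha, hb]
  | tmul a b => simp

theorem mem_conjSub {A : Submodule ℂ (ℂ ⊗[ℚ] H)} {z : ℂ ⊗[ℚ] H} :
    z ∈ conjSub A ↔ conj H z ∈ A := by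
  constructor
  · rintro ⟨y, hy, rfl⟩
    rwa [conj_conj]
  · exact fun h => ⟨_, h, conj_conj z⟩

theorem conj_mem_conjSub {A : Submodule ℂ (ℂ ⊗[ℚ] H)} {z : ℂ ⊗[ℚ] H} (h : z ∈ A) :
    conj H z ∈ conjSub A := ⟨z, h, rfl⟩

theorem conjSub_conjSub (A : Submodule ℂ (ℂ ⊗[ℚ] H)) : conjSub (conjSub A) = A := by
  ext z
  rw [mem_conjSub, mem_conjSub, conj_conj]

variable (H) in
/-- Complex conjugation of subspaces as an order isomorphism. -/
def conjIso : Submodule ℂ (ℂ ⊗[ℚ] H) ≃o Submodule ℂ (ℂ ⊗[ℚ] H) where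
  toFun := conjSub
  invFun := conjSub
  left_inv := conjSub_conjSub
  right_inv := conjSub_conjSub
  map_rel_iff' {A B} := by
    refine ⟨fun h z hz => ?_, fun h => Submodule.map_mono h⟩
    have : conj H z ∈ conjSub B := h (conj_mem_conjSub hz)
    rwa [mem_conjSub, conj_conj] at this

theorem conjIso_apply (A : Submodule ℂ (ℂ ⊗[ℚ] H)) : conjIso H A = conjSub A := rfl

theorem baseChange_eq_range (A : Submodule ℚ H) :
    A.baseChange ℂ = LinearMap.range (A.subtype.baseChange ℂ) := rfl

theorem conj_mem_baseChange {A : Submodule ℚ H} {z : ℂ ⊗[ℚ] H} (hz : z ∈ A.baseChange ℂ) :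
    conj H z ∈ A.baseChange ℂ := by
  rw [baseChange_eq_range] at hz ⊢
  obtain ⟨y, rfl⟩ := hz
  rw [conj_baseChange]
  exact ⟨_, rfl⟩

theorem conjSub_baseChange (A : Submodule ℚ H) :
    conjSub (A.baseChange ℂ) = A.baseChange ℂ := by
  ext z
  rw [mem_conjSub]
  refine ⟨fun h => ?_, conj_mem_baseChange⟩
  simpa using conj_mem_baseChange h

theorem baseChange_subtype_injective (A : Submodule ℚ H) :
    Function.Injective (A.subtype.baseChange ℂ) :=
  Module.Flat.lTensor_preserves_injective_linearMap (M := ℂ) A.subtype A.subtype_injective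

theorem baseChange_mkQ_surjective (A : Submodule ℚ H) :
    Function.Surjective (A.mkQ.baseChange ℂ) :=
  LinearMap.lTensor_surjective ℂ A.mkQ_surjective

theorem ker_baseChange_mkQ (A : Submodule ℚ H) :
    LinearMap.ker (A.mkQ.baseChange ℂ) = LinearMap.range (A.subtype.baseChange ℂ) := by
  have h := lTensor_exact ℂ (f := A.subtype) (g := A.mkQ)
    (LinearMap.exact_subtype_mkQ A) A.mkQ_surjective
  ext z
  exact h z

theorem map_subtype_range (A B : Submodule ℚ H) (hBA : B ≤ A) :
    (LinearMap.range ((B.submoduleOf A).subtype.baseChange ℂ)).map (A.subtype.baseChange ℂ) =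
      B.baseChange ℂ := by
  rw [← LinearMap.range_comp, ← LinearMap.baseChange_comp, baseChange_eq_range]
  have hs : Function.Surjective
      (LinearMap.codRestrict B (A.subtype ∘ₗ (B.submoduleOf A).subtype) fun c => c.2) :=
    fun b => ⟨⟨⟨b, hBA b.2⟩, b.2⟩, rfl⟩
  have : A.subtype ∘ₗ (B.submoduleOf A).subtype = B.subtype ∘ₗ
      (LinearMap.codRestrict B (A.subtype ∘ₗ (B.submoduleOf A).subtype) fun c => c.2) := rfl
  rw [this, LinearMap.baseChange_comp, LinearMap.range_comp_of_range_eq_top]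
  exact LinearMap.range_eq_top.2 (LinearMap.lTensor_surjective ℂ hs)

theorem mkQ_eq_zero_iff {A B : Submodule ℚ H} (hBA : B ≤ A) (a : ℂ ⊗[ℚ] A) :
    (B.submoduleOf A).mkQ.baseChange ℂ a = 0 ↔ A.subtype.baseChange ℂ a ∈ B.baseChange ℂ := by
  rw [← LinearMap.mem_ker, ker_baseChange_mkQ, ← map_subtype_range A B hBA]
  exact ((baseChange_subtype_injective A).mem_set_image (s := SetLike.coe _)).symm

/-- Translates conditions on a graded quotient into the interval [B, A] of subspaces, where the
lattice argument takes place. -/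
theorem mkQ_mem_inducedFiltration {A B : Submodule ℚ H} (hBA : B ≤ A)
    (F : Submodule ℂ (ℂ ⊗[ℚ] H)) (a : ℂ ⊗[ℚ] A) :
    (B.submoduleOf A).mkQ.baseChange ℂ a ∈ inducedFiltration F A B ↔
      A.subtype.baseChange ℂ a ∈ F ⊓ A.baseChange ℂ ⊔ B.baseChange ℂ := by
  constructor
  · rintro ⟨b, hb, hab⟩
    have : A.subtype.baseChange ℂ (a - b) ∈ B.baseChange ℂ := by
      rw [← mkQ_eq_zero_iff hBA, map_sub, hab, sub_self]
    have h2 : A.subtype.baseChange ℂ a =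
        A.subtype.baseChange ℂ b + A.subtype.baseChange ℂ (a - b) := by simp
    rw [h2]
    refine Submodule.add_mem_sup ⟨hb, ?_⟩ this
    rw [baseChange_eq_range]
    exact ⟨b, rfl⟩
  · intro h
    obtain ⟨x, ⟨hx, hxA⟩, y, hy, hxy⟩ := Submodule.mem_sup.1 h
    rw [baseChange_eq_range] at hxA
    obtain ⟨b, rfl⟩ := hxA
    refine ⟨b, hx, ?_⟩
    rw [← sub_eq_zero, ← map_sub, mkQ_eq_zero_iff hBA, map_sub, ← hxy, sub_add_cancel_left]
    exact neg_mem hy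

theorem finrank_map_add_finrank_inf_ker {K M N : Type*} [Field K] [AddCommGroup M] [Module K M]
    [AddCommGroup N] [Module K N] [FiniteDimensional K M] (f : M →ₗ[K] N) (p : Submodule K M) :
    Module.finrank K (p.map f) + Module.finrank K ↥(p ⊓ LinearMap.ker f) =
      Module.finrank K p := by
  rw [← LinearMap.finrank_range_add_finrank_ker (f.domRestrict p), LinearMap.range_domRestrict,
    ← Submodule.map_comap_subtype, Submodule.finrank_map_subtype_eq]
  rfl

/-- Dimension count for the exact sequence 0 → F ∩ B → F ∩ A → F Gr → 0. -/
theorem finrank_inducedFiltration [FiniteDimensional ℚ H] {A B : Submodule ℚ H} (hBA : B ≤ A)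
    (F : Submodule ℂ (ℂ ⊗[ℚ] H)) :
    Module.finrank ℂ ↥(F ⊓ A.baseChange ℂ) =
      Module.finrank ℂ (inducedFiltration F A B) + Module.finrank ℂ ↥(F ⊓ B.baseChange ℂ) := by
  have h1 : (F.comap (A.subtype.baseChange ℂ)).map (A.subtype.baseChange ℂ) =
      F ⊓ A.baseChange ℂ := by
    rw [Submodule.map_comap_eq, ← baseChange_eq_range, inf_comm]
  have h2 : (F.comap (A.subtype.baseChange ℂ) ⊓
      LinearMap.ker ((B.submoduleOf A).mkQ.baseChange ℂ)).map (A.subtype.baseChange ℂ) =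
      F ⊓ B.baseChange ℂ := by
    rw [ker_baseChange_mkQ, Submodule.map_inf _ (baseChange_subtype_injective A), h1,
      map_subtype_range A B hBA, inf_assoc, inf_eq_right.2 (Submodule.baseChange_mono _ hBA)]
  rw [← h1, ← h2, ← (Submodule.equivMapOfInjective _ (baseChange_subtype_injective A) _).finrank_eq,
    ← (Submodule.equivMapOfInjective _ (baseChange_subtype_injective A) _).finrank_eq]
  exact (finrank_map_add_finrank_inf_ker _ _).symm

/-- A filtration inducing pure Hodge structures on the graded quotients is a mixed Hodge
structure. -/
theorem isMixedHodge {F : ℤ → Submodule ℂ (ℂ ⊗[ℚ] H)} {W : ℤ → Submodule ℚ H}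
    (hW : Monotone W) (hWbot : ∃ k, W k = ⊥) (hWtop : ∃ k, W k = ⊤) (hF : Antitone F)
    (hFtop : ∃ k, F k = ⊤) (hFbot : ∃ k, F k = ⊥)
    (hgr : ∀ k, IsPure k fun p => inducedFiltration (F p) (W k) (W (k - 1))) :
    IsMixedHodge (conjIso H) F fun k => (W k).baseChange ℂ where
  invol := conjSub_conjSub
  conj_weight k := conjSub_baseChange _
  mono i j hij := Submodule.baseChange_mono _ (hW hij)
  anti := hF
  weight_bot := hWbot.imp fun k hk => by simp [hk]
  weight_top := hWtop.imp fun k hk => by simp [hk]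
  hodge_bot := hFbot
  hodge_top := hFtop
  inf_le k p := by
    have hBA : W (k - 1) ≤ W k := hW (by omega)
    rintro z ⟨h1, h2⟩
    have hzA : z ∈ (W k).baseChange ℂ :=
      (sup_le inf_le_right (Submodule.baseChange_mono _ hBA) :
        F p ⊓ (W k).baseChange ℂ ⊔ (W (k - 1)).baseChange ℂ ≤ _) h1
    rw [baseChange_eq_range] at hzA
    obtain ⟨a, rfl⟩ := hzA
    rw [← mkQ_eq_zero_iff hBA, ← Submodule.mem_bot ℂ, ← ((hgr k).isCompl p).inf_eq_bot]
    refine ⟨(mkQ_mem_inducedFiltration hBA _ _).2 h1, mem_conjSub.2 ?_⟩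
    rw [conj_baseChange, mkQ_mem_inducedFiltration hBA, ← conj_baseChange, ← mem_conjSub,
      ← conjIso_apply, OrderIso.map_sup, OrderIso.map_inf]
    simpa only [conjIso_apply, conjSub_baseChange, SetLike.mem_coe] using h2
  le_sup k p := by
    have hBA : W (k - 1) ≤ W k := hW (by omega)
    intro z hzA
    rw [baseChange_eq_range] at hzA
    obtain ⟨a, rfl⟩ := hzA
    have ha : (((W (k - 1)).submoduleOf (W k)).mkQ.baseChange ℂ) a ∈
      inducedFiltration (F p) (W k) (W (k - 1)) ⊔
        conjSub (inducedFiltration (F (k - p + 1)) (W k) (W (k - 1))) := by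
      rw [((hgr k).isCompl p).sup_eq_top]
      trivial
    obtain ⟨x, hx, y, hy, hxy⟩ := Submodule.mem_sup.1 ha
    obtain ⟨b, rfl⟩ := baseChange_mkQ_surjective _ x
    have hab : y = (((W (k - 1)).submoduleOf (W k)).mkQ.baseChange ℂ) (a - b) := by
      rw [map_sub, ← hxy, add_sub_cancel_left]
    rw [hab, mem_conjSub, conj_baseChange, mkQ_mem_inducedFiltration hBA, ← conj_baseChange,
      ← mem_conjSub, ← conjIso_apply, OrderIso.map_sup, OrderIso.map_inf] at hy
    simp only [conjIso_apply, conjSub_baseChange] at hy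
    have h2 : (W k).subtype.baseChange ℂ a =
        (W k).subtype.baseChange ℂ b + (W k).subtype.baseChange ℂ (a - b) := by simp
    rw [h2]
    exact Submodule.add_mem_sup ((mkQ_mem_inducedFiltration hBA _ _).1 hx) hy

theorem isDeligneBigrading_iff {F : ℤ → Submodule ℂ (ℂ ⊗[ℚ] H)} {W : ℤ → Submodule ℚ H}
    (hWtop : ∃ k, W k = ⊤) (J : ℤ → ℤ → Submodule ℂ (ℂ ⊗[ℚ] H)) :
    IsDeligneBigrading F W J ↔
      IsBigrading (conjIso H) F (fun k => (W k).baseChange ℂ) fun i => J i.1 i.2 := by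
  have e := fun P => iSup_iSup_eq_supOver (I := fun i : ℤ × ℤ => J i.1 i.2) P
  constructor
  · intro h
    refine ⟨h.isInternal.submodule_iSupIndep, fun p => ?_, fun k => ?_, fun i => ?_⟩
    · rw [h.hodge_eq]
      exact e fun i => p ≤ i.1
    · rw [h.weight_eq]
      exact e fun i => i.1 + i.2 ≤ k
    · have := h.conj_eq i.1 i.2
      rw [e fun j => j.1 < i.1 ∧ j.2 < i.2] at this
      exact this
  · intro h
    refine ⟨?_, fun p => ?_, fun k => ?_, fun p q => ?_⟩
    · rw [DirectSum.isInternal_submodule_iff_iSupIndep_and_iSup_eq_top]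
      refine ⟨h.indep, ?_⟩
      obtain ⟨M, hM⟩ := hWtop
      have := h.supOver_univ (M := M) (by simp [hM])
      simpa [supOver] using this
    · rw [h.hodge]
      exact (e fun i => p ≤ i.1).symm
    · have := h.weight k
      rw [this]
      exact (e fun i => i.1 + i.2 ≤ k).symm
    · rw [e fun j => j.1 < p ∧ j.2 < q]
      exact h.conj (p, q)

end Hodge

/-! ## Regular functions with values in a complex vector space

`RegularAt 𝕜 E n f x` expresses that `f`, with values in a complex vector space without a chosen
norm, is `C^n` over `𝕜` at `x`. -/

section Regular

variable (𝕜 : Type) [NontriviallyNormedField 𝕜] [NormedAlgebra 𝕜 ℂ]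
  (E : Type w) [NormedAddCommGroup E] [NormedSpace 𝕜 E]
  {S : Type u} [TopologicalSpace S] [ChartedSpace E S] (n : WithTop ℕ∞)
  {V : Type*} [AddCommGroup V] [Module ℂ V] {V' : Type*} [AddCommGroup V'] [Module ℂ V']

/-- The algebra of complex valued functions which are `C^n` over `𝕜` at `x`. -/
def regularFunctions (x : S) : Subalgebra ℂ (S → ℂ) where
  carrier := {f | ContMDiffAt 𝓘(𝕜, E) 𝓘(𝕜, ℂ) n f x}
  mul_mem' {f g} hf hg :=
    ContMDiffAt.comp (g := fun p : ℂ × ℂ => p.1 * p.2) (f := fun s => (f s, g s)) x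
      (contDiff_fst.mul contDiff_snd).contMDiff.contMDiffAt (ContMDiffAt.prodMk_space hf hg)
  add_mem' {f g} hf hg :=
    ContMDiffAt.comp (g := fun p : ℂ × ℂ => p.1 + p.2) (f := fun s => (f s, g s)) x
      (contDiff_fst.add contDiff_snd).contMDiff.contMDiffAt (ContMDiffAt.prodMk_space hf hg)
  algebraMap_mem' _ := contMDiffAt_const

variable {𝕜 E n}

theorem mem_regularFunctions {f : S → ℂ} {x : S} :
    f ∈ regularFunctions 𝕜 E n x ↔ ContMDiffAt 𝓘(𝕜, E) 𝓘(𝕜, ℂ) n f x := Iff.rfl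

theorem regularFunctions_congr {f g : S → ℂ} {x : S} (hf : f ∈ regularFunctions 𝕜 E n x)
    (h : g =ᶠ[𝓝 x] f) : g ∈ regularFunctions 𝕜 E n x :=
  ContMDiffAt.congr_of_eventuallyEq hf h

theorem inv_mem_regularFunctions {f : S → ℂ} {x : S} (hf : f ∈ regularFunctions 𝕜 E n x)
    (h : f x ≠ 0) : (fun s => (f s)⁻¹) ∈ regularFunctions 𝕜 E n x :=
  ContMDiffAt.comp (g := fun z : ℂ => z⁻¹) (f := f) x (contDiffAt_inv 𝕜 h).contMDiffAt hf

variable (𝕜 E n) in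
/-- Regularity at `x` of a function with values in a complex vector space. -/
def RegularAt (f : S → V) (x : S) : Prop :=
  ∀ l : V →ₗ[ℂ] ℂ, (fun s => l (f s)) ∈ regularFunctions 𝕜 E n x

namespace RegularAt

variable {f g : S → V} {x : S}

theorem congr (hf : RegularAt 𝕜 E n f x) (h : g =ᶠ[𝓝 x] f) : RegularAt 𝕜 E n g x :=
  fun l => regularFunctions_congr (hf l) (h.fun_comp l)

theorem const (v : V) : RegularAt 𝕜 E n (fun _ : S => v) x :=
  fun l => (regularFunctions 𝕜 E n x).algebraMap_mem (l v)

theorem add (hf : RegularAt 𝕜 E n f x) (hg : RegularAt 𝕜 E n g x) :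
    RegularAt 𝕜 E n (fun s => f s + g s) x := fun l => by
  simp only [map_add]
  exact add_mem (hf l) (hg l)

theorem sub (hf : RegularAt 𝕜 E n f x) (hg : RegularAt 𝕜 E n g x) :
    RegularAt 𝕜 E n (fun s => f s - g s) x := fun l => by
  simp only [map_sub]
  exact sub_mem (hf l) (hg l)

theorem smul {c : S → ℂ} (hc : c ∈ regularFunctions 𝕜 E n x) (hf : RegularAt 𝕜 E n f x) :
    RegularAt 𝕜 E n (fun s => c s • f s) x := fun l => by
  simp only [map_smul, smul_eq_mul]
  exact mul_mem hc (hf l)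

theorem sum {ι : Type*} {t : Finset ι} {f : ι → S → V} (hf : ∀ i ∈ t, RegularAt 𝕜 E n (f i) x) :
    RegularAt 𝕜 E n (fun s => ∑ i ∈ t, f i s) x := fun l => by
  simp only [map_sum]
  have := sum_mem (S := regularFunctions 𝕜 E n x) fun i hi => hf i hi l
  convert this
  simp

theorem map (hf : RegularAt 𝕜 E n f x) (T : V →ₗ[ℂ] V') :
    RegularAt 𝕜 E n (fun s => T (f s)) x := fun l => hf (l ∘ₗ T)

theorem of_basis {ι : Type*} [Fintype ι] (b : Module.Basis ι ℂ V)
    (h : ∀ i, (fun s => b.repr (f s) i) ∈ regularFunctions 𝕜 E n x) : RegularAt 𝕜 E n f x := by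
  have : f = fun s => ∑ i, b.repr (f s) i • b i := funext fun s => (b.sum_repr _).symm
  rw [this]
  exact sum fun i _ => smul (h i) (const _)

/-- A regular family of linear maps applied to a regular function. -/
theorem apply [FiniteDimensional ℂ V] {Φ : S → V →ₗ[ℂ] V'}
    (hΦ : ∀ v, RegularAt 𝕜 E n (fun s => Φ s v) x) (hf : RegularAt 𝕜 E n f x) :
    RegularAt 𝕜 E n (fun s => Φ s (f s)) x := by
  let b := Module.finBasis ℂ V
  have : (fun s => Φ s (f s)) = fun s => ∑ i, b.repr (f s) i • Φ s (b i) := funext fun s => by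
    conv_lhs => rw [← b.sum_repr (f s), map_sum]
    simp
  rw [this]
  exact sum fun i _ => smul (hf (b.coord i)) (hΦ _)

end RegularAt

/-- The inverse of a regular family of linear maps is regular. -/
theorem exists_regularAt_inverse [FiniteDimensional ℂ V] [FiniteDimensional ℂ V']
    {Φ : S → V →ₗ[ℂ] V'} {x : S} (hΦ : ∀ v, RegularAt 𝕜 E n (fun s => Φ s v) x)
    (hx : Function.Bijective (Φ x)) :
    ∃ Ψ : S → V' →ₗ[ℂ] V, (∀ v, RegularAt 𝕜 E n (fun s => Ψ s v) x) ∧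
      ∀ᶠ s in 𝓝 x, Ψ s ∘ₗ Φ s = LinearMap.id ∧ Φ s ∘ₗ Ψ s = LinearMap.id := by
  classical
  let e := LinearEquiv.ofBijective (Φ x) hx
  let b := Module.finBasis ℂ V
  -- With the image basis on the target, the matrix at x is the identity.
  let b' := b.map e
  let A := regularFunctions 𝕜 E n x
  let M : S → Matrix _ _ ℂ := fun s => LinearMap.toMatrix b b' (Φ s)
  -- Viewed over the ring A of regular functions, the matrix has its determinant and adjugate in A
  -- automatically; the evaluation homomorphisms recover the pointwise values, and Cramer's rule
  -- gives the inverse.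
  let N : Matrix (Fin (Module.finrank ℂ V)) (Fin (Module.finrank ℂ V)) A := fun i j =>
    ⟨fun s => M s i j, by
      have := hΦ (b j) (b'.coord i)
      simpa [M, LinearMap.toMatrix_apply] using this⟩
  let ev : S → A →+* ℂ := fun s => (Pi.evalRingHom (fun _ : S => ℂ) s).comp (A.val : A →+* (S → ℂ))
  have hN : ∀ s, (ev s).mapMatrix N = M s := fun s => rfl
  have hdet : ∀ s, ev s N.det = (M s).det := fun s => by rw [RingHom.map_det, hN]
  have hadj : ∀ s i j, ev s (N.adjugate i j) = (M s).adjugate i j := fun s i j => by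
    rw [← hN s, ← RingHom.map_adjugate]
    rfl
  have hdetA : (fun s => (M s).det) ∈ A := by
    convert N.det.2
    exact (hdet _).symm
  have hadjA : ∀ i j, (fun s => (M s).adjugate i j) ∈ A := fun i j => by
    convert (N.adjugate i j).2
    exact (hadj _ i j).symm
  have hMx : (M x).det ≠ 0 := by
    have : M x = 1 := by
      ext i j
      have : Φ x (b j) = b' j := by simp [b', e]
      simp [M, LinearMap.toMatrix_apply, this, Matrix.one_apply, Finsupp.single_apply, eq_comm]
    simp [this]
  have hev : ∀ᶠ s in 𝓝 x, (M s).det ≠ 0 :=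
    (ContMDiffAt.continuousAt (mem_regularFunctions.1 hdetA)).eventually_ne hMx
  refine ⟨fun s => Matrix.toLin b' b (M s)⁻¹, fun v => RegularAt.of_basis b fun i => ?_, ?_⟩
  · have : (fun s => b.repr (Matrix.toLin b' b (M s)⁻¹ v) i) =
        fun s => ∑ j, ((M s).det⁻¹ * (M s).adjugate i j) * b'.repr v j := funext fun s => by
      rw [Matrix.repr_toLin, Matrix.inv_def, Ring.inverse_eq_inv']
      simp [Matrix.mulVec, dotProduct]
    rw [this]
    have h1 : ∀ j, (fun s => ((M s).det⁻¹ * (M s).adjugate i j) * b'.repr v j) ∈ A := fun j =>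
      mul_mem (mul_mem (inv_mem_regularFunctions hdetA hMx) (hadjA i j))
        (A.algebraMap_mem (b'.repr v j))
    convert sum_mem (S := A) fun j (_ : j ∈ Finset.univ) => h1 j
    simp
  · filter_upwards [hev] with s hs
    have hu : IsUnit (M s).det := isUnit_iff_ne_zero.2 hs
    have h1 : Φ s = Matrix.toLin b b' (M s) := (Matrix.toLin_toMatrix b b' (Φ s)).symm
    rw [h1, ← Matrix.toLin_mul, ← Matrix.toLin_mul, Matrix.nonsing_inv_mul _ hu,
      Matrix.mul_nonsing_inv _ hu, Matrix.toLin_one, Matrix.toLin_one]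
    exact ⟨rfl, rfl⟩

theorem regularAt_linearCombination {κ : Type*} [Fintype κ] {b : κ → S → V} {x : S}
    (hb : ∀ k, RegularAt 𝕜 E n (b k) x) (a : κ → ℂ) :
    RegularAt 𝕜 E n (fun s => Fintype.linearCombination ℂ (fun k => b k s) a) x := by
  simp only [Fintype.linearCombination_apply]
  exact RegularAt.sum fun k _ => RegularAt.smul (Subalgebra.algebraMap_mem _ (a k)) (hb k)

/-- Composing the frame map with a fixed left inverse of its value at x gives a regular family of
square matrices, equal to the identity at x and hence invertible nearby. -/
theorem exists_regularAt_leftInverse [FiniteDimensional ℂ V] {κ : Type*} [Fintype κ]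
    {b : κ → S → V} {x : S}
    (hb : ∀ k, RegularAt 𝕜 E n (b k) x) (hli : LinearIndependent ℂ fun k => b k x) :
    ∃ Ψ : S → V →ₗ[ℂ] κ → ℂ,
      (∀ f : S → V, RegularAt 𝕜 E n f x → RegularAt 𝕜 E n (fun s => Ψ s (f s)) x) ∧
      ∀ᶠ s in 𝓝 x, Ψ s ∘ₗ Fintype.linearCombination ℂ (fun k => b k s) = LinearMap.id := by
  obtain ⟨π, hπ⟩ := LinearMap.exists_leftInverse_of_injective
    (Fintype.linearCombination ℂ fun k => b k x)
    (LinearMap.ker_eq_bot.2 (linearIndependent_iff_injective_fintypeLinearCombination.1 hli))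
  obtain ⟨Ψ, hΨ, h⟩ := exists_regularAt_inverse (𝕜 := 𝕜) (E := E) (n := n)
    (Φ := fun s => π ∘ₗ Fintype.linearCombination ℂ fun k => b k s) (x := x)
    (fun a => (regularAt_linearCombination hb a).map π)
    (by rw [hπ]; exact Function.bijective_id)
  exact ⟨fun s => Ψ s ∘ₗ π, fun f hf => RegularAt.apply (Φ := Ψ) hΨ (hf.map π),
    h.mono fun s hs => hs.1⟩

/-- The coefficients of a regular function in a regular frame are regular. -/
theorem coeff_mem_regularFunctions [FiniteDimensional ℂ V] {κ : Type*} [Fintype κ]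
    {b : κ → S → V} {x : S}
    (hb : ∀ k, RegularAt 𝕜 E n (b k) x) (hli : LinearIndependent ℂ fun k => b k x) {f : S → V}
    (hf : RegularAt 𝕜 E n f x) {c : κ → S → ℂ} (hc : ∀ᶠ s in 𝓝 x, f s = ∑ k, c k s • b k s)
    (k : κ) : c k ∈ regularFunctions 𝕜 E n x := by
  obtain ⟨Ψ, hΨ, h⟩ := exists_regularAt_leftInverse hb hli
  refine regularFunctions_congr (hΨ f hf (LinearMap.proj k)) ?_
  filter_upwards [h, hc] with s hs hcs
  have h1 : f s = Fintype.linearCombination ℂ (fun k => b k s) (fun k => c k s) := by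
    rw [hcs, Fintype.linearCombination_apply]
  have h2 := LinearMap.congr_fun hs fun k => c k s
  rw [LinearMap.comp_apply, ← h1] at h2
  rw [h2]
  rfl

/-- Linear independence is an open condition. -/
theorem eventually_linearIndependent [FiniteDimensional ℂ V] {κ : Type*} [Fintype κ]
    {b : κ → S → V} {x : S}
    (hb : ∀ k, RegularAt 𝕜 E n (b k) x) (hli : LinearIndependent ℂ fun k => b k x) :
    ∀ᶠ s in 𝓝 x, LinearIndependent ℂ fun k => b k s := by
  obtain ⟨Ψ, -, h⟩ := exists_regularAt_leftInverse hb hli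
  filter_upwards [h] with s hs
  rw [linearIndependent_iff_injective_fintypeLinearCombination]
  exact Function.LeftInverse.injective fun a => LinearMap.congr_fun hs a

end Regular

/-! ## Differentials of complex valued functions -/

section Differential

variable {E : Type w} [NormedAddCommGroup E] {S : Type u} [TopologicalSpace S] [ChartedSpace E S]

theorem mem_regularFunctions_iff_contDiffAt {𝕜 : Type} [NontriviallyNormedField 𝕜]
    [NormedAlgebra 𝕜 ℂ] [NormedSpace 𝕜 E] {n : WithTop ℕ∞} {f : S → ℂ} {x : S} :
    f ∈ regularFunctions 𝕜 E n x ↔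
      ContinuousAt f x ∧ ContDiffAt 𝕜 n (f ∘ (chartAt E x).symm) (chartAt E x x) := by
  rw [mem_regularFunctions, contMDiffAt_iff]
  simp only [extChartAt_model_space_eq_id, PartialEquiv.refl_coe, Function.id_comp,
    modelWithCornersSelf_coe, Set.range_id, contDiffWithinAt_univ]
  rfl

theorem chart_comp_eventuallyEq {Y : Type*} {f g : S → Y} {x : S} (h : f =ᶠ[𝓝 x] g) :
    f ∘ (chartAt E x).symm =ᶠ[𝓝 (chartAt E x x)] g ∘ (chartAt E x).symm := by
  have h1 := (chartAt E x).continuousAt_symm (mem_chart_target E x)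
  rw [ContinuousAt, (chartAt E x).left_inv (mem_chart_source E x)] at h1
  exact h1.eventually h

variable [NormedSpace ℂ E]

theorem regularFunctions_real_of_complex {f : S → ℂ} {x : S}
    (hf : f ∈ regularFunctions ℂ E ω x) : f ∈ regularFunctions ℝ E ∞ x := by
  rw [mem_regularFunctions_iff_contDiffAt] at hf ⊢
  exact ⟨hf.1, (hf.2.restrict_scalars ℝ).of_le le_top⟩

theorem realDifferential_eq {f : S → ℂ} {x : S} (hf : f ∈ regularFunctions ℝ E ∞ x) :
    LocalSystem.realDifferential E f x =
      (fderiv ℝ (f ∘ (chartAt E x).symm) (chartAt E x x)).toLinearMap := by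
  have hd : MDifferentiableAt 𝓘(ℝ, E) 𝓘(ℝ, ℂ) f x :=
    ContMDiffAt.mdifferentiableAt hf (by simp)
  have h := hd.mfderiv
  simp only [writtenInExtChartAt, extChartAt_model_space_eq_id, PartialEquiv.refl_coe,
    Function.id_comp, modelWithCornersSelf_coe, Set.range_id, fderivWithin_univ] at h
  exact congrArg (fun T : E →L[ℝ] ℂ => T.toLinearMap) h

theorem differentiableAt_chart {f : S → ℂ} {x : S} (hf : f ∈ regularFunctions ℝ E ∞ x) :
    DifferentiableAt ℝ (f ∘ (chartAt E x).symm) (chartAt E x x) :=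
  (mem_regularFunctions_iff_contDiffAt.1 hf).2.differentiableAt (by simp)

theorem realDifferential_congr {f g : S → ℂ} {x : S} (hf : f ∈ regularFunctions ℝ E ∞ x)
    (h : g =ᶠ[𝓝 x] f) :
    LocalSystem.realDifferential E g x = LocalSystem.realDifferential E f x := by
  rw [realDifferential_eq hf, realDifferential_eq (regularFunctions_congr hf h),
    (chart_comp_eventuallyEq h).fderiv_eq]

theorem realDifferential_const (c : ℂ) (x : S) :
    LocalSystem.realDifferential E (fun _ : S => c) x = 0 := by
  rw [realDifferential_eq (f := fun _ : S => c)
    (Subalgebra.algebraMap_mem (regularFunctions ℝ E ∞ x) c)]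
  ext ξ
  simp [Function.comp_def]

theorem realDifferential_add {f g : S → ℂ} {x : S} (hf : f ∈ regularFunctions ℝ E ∞ x)
    (hg : g ∈ regularFunctions ℝ E ∞ x) (ξ : E) :
    LocalSystem.realDifferential E (fun s => f s + g s) x ξ =
      LocalSystem.realDifferential E f x ξ + LocalSystem.realDifferential E g x ξ := by
  rw [realDifferential_eq hf, realDifferential_eq hg,
    realDifferential_eq (f := fun s => f s + g s) (add_mem hf hg)]
  have := fderiv_add (differentiableAt_chart hf) (differentiableAt_chart hg)
  exact congrArg (fun T : E →L[ℝ] ℂ => T ξ) this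

theorem realDifferential_mul {f g : S → ℂ} {x : S} (hf : f ∈ regularFunctions ℝ E ∞ x)
    (hg : g ∈ regularFunctions ℝ E ∞ x) (ξ : E) :
    LocalSystem.realDifferential E (fun s => f s * g s) x ξ =
      LocalSystem.realDifferential E f x ξ * g x + f x * LocalSystem.realDifferential E g x ξ := by
  rw [realDifferential_eq hf, realDifferential_eq hg,
    realDifferential_eq (f := fun s => f s * g s) (mul_mem hf hg)]
  have := congrArg (fun T : E →L[ℝ] ℂ => T ξ)
    (fderiv_mul (differentiableAt_chart hf) (differentiableAt_chart hg))
  have e : (chartAt E x).symm (chartAt E x x) = x :=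
    (chartAt E x).left_inv (mem_chart_source E x)
  refine Eq.trans this ?_
  simp only [Function.comp_apply, e, add_apply,
    smul_apply, smul_eq_mul, ContinuousLinearMap.coe_coe]
  ring

theorem realDifferential_sum {ι : Type*} {t : Finset ι} {f : ι → S → ℂ} {x : S}
    (hf : ∀ i ∈ t, f i ∈ regularFunctions ℝ E ∞ x) (ξ : E) :
    LocalSystem.realDifferential E (fun s => ∑ i ∈ t, f i s) x ξ =
      ∑ i ∈ t, LocalSystem.realDifferential E (f i) x ξ := by
  classical
  induction t using Finset.induction_on with
  | empty => simp [realDifferential_const]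
  | insert a t ha ih =>
    have h1 : ∀ i ∈ t, f i ∈ regularFunctions ℝ E ∞ x :=
      fun i hi => hf i (Finset.mem_insert_of_mem hi)
    have h2 : (fun s => ∑ i ∈ t, f i s) ∈ regularFunctions ℝ E ∞ x := by
      convert sum_mem h1
      simp
    simp only [Finset.sum_insert ha]
    rw [realDifferential_add (hf a (Finset.mem_insert_self _ _)) h2, ih h1]

theorem star_mem_regularFunctions {f : S → ℂ} {x : S} (hf : f ∈ regularFunctions ℝ E ∞ x) :
    (fun s => starRingEnd ℂ (f s)) ∈ regularFunctions ℝ E ∞ x :=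
  ContMDiffAt.comp (g := fun z : ℂ => starRingEnd ℂ z) (f := f) x
    Complex.conjCLE.contDiff.contMDiff.contMDiffAt hf

theorem realDifferential_star {f : S → ℂ} {x : S} (hf : f ∈ regularFunctions ℝ E ∞ x) (ξ : E) :
    LocalSystem.realDifferential E (fun s => starRingEnd ℂ (f s)) x ξ =
      starRingEnd ℂ (LocalSystem.realDifferential E f x ξ) := by
  rw [realDifferential_eq hf, realDifferential_eq (star_mem_regularFunctions hf)]
  have := (Complex.conjCLE.toContinuousLinearMap.hasFDerivAt.comp _
    (differentiableAt_chart hf).hasFDerivAt).fderiv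
  exact congrArg (fun T : E →L[ℝ] ℂ => T ξ) this

theorem realDifferential_smul_of_complex {f : S → ℂ} {x : S}
    (hf : f ∈ regularFunctions ℂ E ω x) (c : ℂ) (ξ : E) :
    LocalSystem.realDifferential E f x (c • ξ) = c * LocalSystem.realDifferential E f x ξ := by
  have hd : DifferentiableAt ℂ (f ∘ (chartAt E x).symm) (chartAt E x x) :=
    (mem_regularFunctions_iff_contDiffAt.1 hf).2.differentiableAt (by simp)
  rw [realDifferential_eq (regularFunctions_real_of_complex hf), hd.fderiv_restrictScalars ℝ]
  simp

/-- The derivative of a smooth function along the vector fields which are constant in the chart at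
`x` is smooth. -/
theorem realDifferential_tangentCoordChange [IsManifold 𝓘(ℂ, E) ω S] {f : S → ℂ} {x : S}
    (hf : ∀ᶠ s in 𝓝 x, f ∈ regularFunctions ℝ E ∞ s) (v : E) :
    (fun s => LocalSystem.realDifferential E f s (tangentCoordChange 𝓘(ℂ, E) x s s v)) ∈
      regularFunctions ℝ E ∞ x := by
  set φ := chartAt E x with hφ
  have hg : ContDiffAt ℝ ∞ (f ∘ φ.symm) (φ x) :=
    (mem_regularFunctions_iff_contDiffAt.1 hf.self_of_nhds).2
  have hg' : ContDiffAt ℝ ∞ (fun y => fderiv ℝ (f ∘ φ.symm) y v) (φ x) :=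
    (hg.fderiv_right (m := ∞) (by simp)).clm_apply contDiffAt_const
  have hmem : (fun s => fderiv ℝ (f ∘ φ.symm) (φ s) v) ∈ regularFunctions ℝ E ∞ x := by
    rw [mem_regularFunctions_iff_contDiffAt]
    constructor
    · exact ContinuousAt.comp (f := φ) (g := fun y => fderiv ℝ (f ∘ φ.symm) y v)
        hg'.continuousAt (φ.continuousAt (mem_chart_source E x))
    · refine hg'.congr_of_eventuallyEq ?_
      filter_upwards [φ.open_target.mem_nhds (mem_chart_target E x)] with y hy
      simp only [Function.comp_apply, ← hφ, φ.right_inv hy]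
  refine regularFunctions_congr hmem ?_
  filter_upwards [hf, φ.open_source.mem_nhds (mem_chart_source E x)] with s hs hsx
  set ψ := chartAt E s with hψ
  have hss : s ∈ ψ.source := mem_chart_source E s
  rw [realDifferential_eq hs]
  -- The differential at s is computed in the chart at s, which varies with s. The coordinate change
  -- is the derivative of the chart transition, so the chain rule moves everything to the one chart
  -- at x.
  have h1 : HasFDerivAt (ψ ∘ φ.symm) (tangentCoordChange 𝓘(ℂ, E) x s s) (φ s) := by
    have := hasFDerivWithinAt_tangentCoordChange (I := 𝓘(ℂ, E)) (x := x) (y := s) (z := s)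
      (by simpa using hsx)
    simpa [Function.comp_def] using this
  have h2 : HasFDerivAt (f ∘ ψ.symm) (fderiv ℝ (f ∘ ψ.symm) (ψ s)) ((ψ ∘ φ.symm) (φ s)) := by
    rw [Function.comp_apply, φ.left_inv hsx]
    exact (differentiableAt_chart hs).hasFDerivAt
  have h3 := h2.comp (φ s) (h1.restrictScalars ℝ)
  have h4 : f ∘ φ.symm =ᶠ[𝓝 (φ s)] (f ∘ ψ.symm) ∘ (ψ ∘ φ.symm) := by
    have hc := φ.continuousAt_symm (φ.map_source hsx)
    rw [ContinuousAt, φ.left_inv hsx] at hc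
    filter_upwards [hc.eventually (ψ.open_source.mem_nhds hss)] with y hy
    simp [ψ.left_inv hy]
  rw [h4.fderiv_eq, h3.fderiv]
  rfl

end Differential

/-! ## Sections of local systems -/

namespace LocalSystem

section Sections

variable {S : Type u} [TopologicalSpace S] (L : LocalSystem.{u, v, 0} ℂ S)

/-- The section of `L` given near `x` by a function with values in the fiber at `x`. -/
def lift (x : S) (f : S → L.fiber x) : ∀ s, L.fiber s := fun s =>
  Function.invFun (L.transport x s) (f s)

theorem eventually_transport_lift (x : S) :
    ∀ᶠ s in 𝓝 x, ∀ f : S → L.fiber x, L.transport x s (L.lift x f s) = f s := by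
  filter_upwards [L.transport_bijective x] with s hs f
  exact Function.rightInverse_invFun hs.surjective (f s)

theorem lift_self (x : S) (f : S → L.fiber x) : L.lift x f x = f x := by
  simpa [L.transport_self] using (L.eventually_transport_lift x).self_of_nhds f

theorem eventually_finrank_eq (x : S) :
    ∀ᶠ s in 𝓝 x, Module.finrank ℂ (L.fiber s) = Module.finrank ℂ (L.fiber x) := by
  filter_upwards [L.transport_bijective x] with s hs
  exact (LinearEquiv.ofBijective _ hs).finrank_eq

variable {E : Type w} [NormedAddCommGroup E] [ChartedSpace E S]

section Generic

variable {𝕜 : Type} [NontriviallyNormedField 𝕜] [NormedAlgebra 𝕜 ℂ] [NormedSpace 𝕜 E]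
  {n : WithTop ℕ∞}

/-- The trivializations at x and at a nearby s differ by the constant isomorphism `L.transport x s`,
so regularity near x can be tested in the trivialization at x alone. -/
theorem eventually_regularAt_iff (x : S) :
    ∀ᶠ s in 𝓝 x, ∀ σ : ∀ s, L.fiber s,
      RegularAt 𝕜 E n (fun t => L.transport s t (σ t)) s ↔
        RegularAt 𝕜 E n (fun t => L.transport x t (σ t)) s := by
  filter_upwards [L.transport_bijective x, L.transport_comp x] with s hs hc σ
  constructor
  · intro h
    refine (h.map (L.transport x s)).congr ?_
    filter_upwards [hc] with t ht
    rw [← ht]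
    rfl
  · intro h
    refine (h.map (LinearEquiv.ofBijective _ hs).symm.toLinearMap).congr ?_
    filter_upwards [hc] with t ht
    rw [← ht]
    exact ((LinearEquiv.ofBijective _ hs).symm_apply_apply _).symm

theorem eventually_regularAt_lift (x : S) :
    ∀ᶠ s in 𝓝 x, ∀ f : S → L.fiber x, RegularAt 𝕜 E n f s →
      RegularAt 𝕜 E n (fun t => L.transport s t (L.lift x f t)) s := by
  filter_upwards [L.eventually_regularAt_iff (𝕜 := 𝕜) (E := E) (n := n) x,
    (L.eventually_transport_lift x).eventually_nhds] with s hs ht f hf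
  rw [hs]
  refine hf.congr ?_
  filter_upwards [ht] with t ht
  exact ht f

theorem regularAt_sum {κ : Type*} [Fintype κ] {b : κ → ∀ s, L.fiber s} {c : κ → S → ℂ} {x : S}
    (hb : ∀ k, RegularAt 𝕜 E n (fun s => L.transport x s (b k s)) x)
    (hc : ∀ k, c k ∈ regularFunctions 𝕜 E n x) {σ : ∀ s, L.fiber s}
    (h : ∀ᶠ s in 𝓝 x, σ s = ∑ k, c k s • b k s) :
    RegularAt 𝕜 E n (fun s => L.transport x s (σ s)) x := by
  refine (RegularAt.sum (t := Finset.univ) fun k _ => RegularAt.smul (hc k) (hb k)).congr ?_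
  filter_upwards [h] with s hs
  simp [hs]

theorem coeff_mem_regularFunctions {κ : Type*} [Fintype κ] {b : κ → ∀ s, L.fiber s} {x : S}
    (hb : ∀ k, RegularAt 𝕜 E n (fun s => L.transport x s (b k s)) x)
    (hli : LinearIndependent ℂ fun k => b k x) {σ : ∀ s, L.fiber s}
    (hσ : RegularAt 𝕜 E n (fun s => L.transport x s (σ s)) x) {c : κ → S → ℂ}
    (hc : ∀ᶠ s in 𝓝 x, σ s = ∑ k, c k s • b k s) (k : κ) :
    c k ∈ regularFunctions 𝕜 E n x := by
  have e : (fun k => L.transport x x (b k x)) = fun k => b k x := by simp [L.transport_self]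
  refine _root_.coeff_mem_regularFunctions hb (by rwa [e]) hσ ?_ k
  filter_upwards [hc] with s hs
  simp [hs]

theorem eventually_linearIndependent {κ : Type*} [Fintype κ] {b : κ → ∀ s, L.fiber s} {x : S}
    (hb : ∀ k, RegularAt 𝕜 E n (fun s => L.transport x s (b k s)) x)
    (hli : LinearIndependent ℂ fun k => b k x) :
    ∀ᶠ s in 𝓝 x, LinearIndependent ℂ fun k => b k s := by
  have e : (fun k => L.transport x x (b k x)) = fun k => b k x := by simp [L.transport_self]
  filter_upwards [_root_.eventually_linearIndependent hb (by rwa [e])] with s hs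
  exact LinearIndependent.of_comp (L.transport x s) hs

end Generic

variable [NormedSpace ℂ E]

theorem smoothAt_of_holomorphicAt {σ : ∀ s, L.fiber s} {x : S} (h : L.HolomorphicAt E σ x) :
    L.SmoothAt E σ x := fun l => regularFunctions_real_of_complex (h l)

/-! ### The flat connection -/

/-- Frees the connection from the chosen basis: identities for ∇ reduce to scalar differentials. -/
theorem nabla_dual {σ : ∀ s, L.fiber s} {x : S} (h : L.SmoothAt E σ x)
    (l : L.fiber x →ₗ[ℂ] ℂ) (ξ : E) :
    l (L.nabla E σ x ξ) = realDifferential E (fun s => l (L.transport x s (σ s))) x ξ := by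
  set b := Module.finBasis ℂ (L.fiber x) with hb
  have h1 : (fun s => l (L.transport x s (σ s))) =
      fun s => ∑ i, l (b i) * b.coord i (L.transport x s (σ s)) := funext fun s => by
    conv_lhs => rw [← b.sum_repr (L.transport x s (σ s)), map_sum]
    simp [mul_comm]
  rw [h1, realDifferential_sum (f := fun i s => l (b i) * b.coord i (L.transport x s (σ s)))
    (fun i _ => mul_mem (Subalgebra.algebraMap_mem _ (l (b i))) (h (b.coord i)))]
  rw [nabla, LinearMap.sum_apply, map_sum]
  refine Finset.sum_congr rfl fun i _ => ?_
  rw [realDifferential_mul (f := fun _ => l (b i))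
    (Subalgebra.algebraMap_mem _ (l (b i))) (h (b.coord i)), realDifferential_const]
  simp [LinearMap.smulRight_apply, mul_comm, hb]

theorem dual_ext {x : S} {v v' : L.fiber x} (h : ∀ l : L.fiber x →ₗ[ℂ] ℂ, l v = l v') :
    v = v' := by
  rw [← sub_eq_zero, ← Module.forall_dual_apply_eq_zero_iff ℂ]
  intro l
  rw [map_sub, h l, sub_self]

/-- A functional vanishing on B is identically zero along the transported section, so it kills the
derivative. -/
theorem nabla_mem {σ : ∀ s, L.fiber s} {x : S} (h : L.SmoothAt E σ x)
    {B : Submodule ℂ (L.fiber x)} (hB : ∀ᶠ s in 𝓝 x, L.transport x s (σ s) ∈ B) (ξ : E) :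
    L.nabla E σ x ξ ∈ B := by
  by_contra hn
  obtain ⟨l, hl, hBl⟩ := Submodule.exists_le_ker_of_notMem hn
  refine hl ?_
  rw [nabla_dual L h, realDifferential_congr (f := fun _ => (0 : ℂ))
    (Subalgebra.zero_mem _), realDifferential_const, LinearMap.zero_apply]
  filter_upwards [hB] with s hs
  exact hBl hs

theorem nabla_sum {κ : Type*} [Fintype κ] {b : κ → ∀ s, L.fiber s} {c : κ → S → ℂ} {x : S}
    (hb : ∀ k, L.SmoothAt E (b k) x) (hc : ∀ k, c k ∈ regularFunctions ℝ E ∞ x)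
    {σ : ∀ s, L.fiber s} (h : ∀ᶠ s in 𝓝 x, σ s = ∑ k, c k s • b k s) (ξ : E) :
    L.nabla E σ x ξ =
      ∑ k, (realDifferential E (c k) x ξ • b k x + c k x • L.nabla E (b k) x ξ) := by
  have hσ : L.SmoothAt E σ x := L.regularAt_sum hb hc h
  refine L.dual_ext fun l => ?_
  rw [nabla_dual L hσ]
  have hm : ∀ k, (fun s => c k s * l (L.transport x s (b k s))) ∈ regularFunctions ℝ E ∞ x :=
    fun k => mul_mem (hc k) (hb k l)
  rw [realDifferential_congr (f := fun s => ∑ k, c k s * l (L.transport x s (b k s))),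
    realDifferential_sum (fun k _ => hm k), map_sum]
  · refine Finset.sum_congr rfl fun k _ => ?_
    rw [realDifferential_mul (hc k) (hb k l), map_add, map_smul, map_smul, nabla_dual L (hb k)]
    simp [L.transport_self]
  · convert sum_mem fun k (_ : k ∈ Finset.univ) => hm k
    simp
  · filter_upwards [h] with s hs
    simp [hs]

theorem nabla_smul_of_holomorphicAt {σ : ∀ s, L.fiber s} {x : S} (h : L.HolomorphicAt E σ x)
    (c : ℂ) (ξ : E) : L.nabla E σ x (c • ξ) = c • L.nabla E σ x ξ := by
  have hs := L.smoothAt_of_holomorphicAt h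
  refine L.dual_ext fun l => ?_
  rw [nabla_dual L hs, realDifferential_smul_of_complex (h l), l.map_smul, nabla_dual L hs,
    smul_eq_mul]

variable [IsManifold 𝓘(ℂ, E) ω S]

theorem smoothFormAt_nabla {σ : ∀ s, L.fiber s} {x : S}
    (h : ∀ᶠ s in 𝓝 x, L.SmoothAt E σ s) : L.SmoothFormAt E (L.nabla E σ) x := by
  intro v l
  have h1 := L.eventually_regularAt_iff (𝕜 := ℝ) (E := E) (n := ∞) x
  have h2 : ∀ᶠ s in 𝓝 x, (fun t => l (L.transport x t (σ t))) ∈ regularFunctions ℝ E ∞ s := by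
    filter_upwards [h, h1] with s hs hs1
    exact (hs1 σ).1 hs l
  refine regularFunctions_congr (realDifferential_tangentCoordChange h2 v) ?_
  filter_upwards [h, h2, L.transport_comp x] with s hs hs2 hc
  have := L.nabla_dual hs (l ∘ₗ L.transport x s) (tangentCoordChange 𝓘(ℂ, E) x s s v)
  rw [LinearMap.comp_apply] at this
  rw [this, realDifferential_congr hs2]
  filter_upwards [hc] with t ht
  rw [← ht]
  rfl

end Sections

/-! ### Complex conjugation of sections -/

section Conj

variable {S : Type u} [TopologicalSpace S] (L : LocalSystem.{u, v, 0} ℚ S)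
  {E : Type w} [NormedAddCommGroup E] [NormedSpace ℂ E] [ChartedSpace E S]

/-- The complex conjugate of a linear functional. -/
def conjDual {H : Type*} [AddCommGroup H] [Module ℚ H] (l : (ℂ ⊗[ℚ] H) →ₗ[ℂ] ℂ) :
    (ℂ ⊗[ℚ] H) →ₗ[ℂ] ℂ where
  toFun z := starRingEnd ℂ (l (Hodge.conj H z))
  map_add' := by simp
  map_smul' := by simp

/-- The complex conjugate of a section. -/
def conjSection (σ : ∀ s, L.complexify.fiber s) : ∀ s, L.complexify.fiber s := fun s =>
  Hodge.conj (L.fiber s) (σ s)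

variable {L} in
theorem dual_transport_conjSection {σ : ∀ s, L.complexify.fiber s} {x s : S}
    (l : L.complexify.fiber x →ₗ[ℂ] ℂ) :
    l (L.complexify.transport x s (L.conjSection σ s)) =
      starRingEnd ℂ (conjDual l (L.complexify.transport x s (σ s))) := by
  have : L.complexify.transport x s (L.conjSection σ s) =
    Hodge.conj (L.fiber x) (L.complexify.transport x s (σ s)) :=
    (Hodge.conj_baseChange (L.transport x s) (σ s)).symm
  rw [this]
  exact (Complex.conj_conj _).symm

theorem smoothAt_conjSection {σ : ∀ s, L.complexify.fiber s} {x : S}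
    (h : L.complexify.SmoothAt E σ x) : L.complexify.SmoothAt E (L.conjSection σ) x := by
  intro l
  exact regularFunctions_congr (star_mem_regularFunctions (h (conjDual l)))
    (Eventually.of_forall fun s => dual_transport_conjSection l)

/-- Parallel transport is rational and so commutes with conjugation. -/
theorem nabla_conjSection {σ : ∀ s, L.complexify.fiber s} {x : S}
    (h : L.complexify.SmoothAt E σ x) (ξ : E) :
    L.complexify.nabla E (L.conjSection σ) x ξ =
      Hodge.conj (L.fiber x) (L.complexify.nabla E σ x ξ) := by
  refine L.complexify.dual_ext fun l => ?_
  rw [nabla_dual _ (L.smoothAt_conjSection h)]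
  rw [realDifferential_congr (star_mem_regularFunctions (h (conjDual l)))
    (Eventually.of_forall fun s => dual_transport_conjSection l),
    realDifferential_star (h (conjDual l)), ← nabla_dual _ h]
  exact Complex.conj_conj _

end Conj

end LocalSystem

/-! ### Holomorphic extension of vectors in the intersection with a flat subbundle. -/

namespace LocalSystem

section Extension

variable {S : Type u} [TopologicalSpace S] (L : LocalSystem.{u, v, 0} ℂ S)
  {E : Type w} [NormedAddCommGroup E] [NormedSpace ℂ E] [ChartedSpace E S]

theorem eventually_finrank_of_isHolomorphicSubbundle {A : ∀ s, Submodule ℂ (L.fiber s)}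
    (hA : L.IsHolomorphicSubbundle E A) (x : S) :
    ∀ᶠ s in 𝓝 x, Module.finrank ℂ (A s) = Module.finrank ℂ (A x) := by
  obtain ⟨O, hO, hx, k, e, -, he⟩ := hA x
  have h : ∀ s ∈ O, Module.finrank ℂ (A s) = k := fun s hs => by
    rw [← (he s hs).2, finrank_span_eq_card (he s hs).1, Fintype.card_fin]
  filter_upwards [hO.mem_nhds hx] with s hs
  rw [h s hs, h x hx]

/-- If the rank of `A ∩ B` is locally constant for a holomorphic subbundle `A` and a flat subbundle
`B`, then vectors in `A ∩ B` extend to local holomorphic sections. -/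
theorem exists_holomorphic_extension {A B : ∀ s, Submodule ℂ (L.fiber s)}
    (hA : L.IsHolomorphicSubbundle E A) (hB : L.IsFlatSub B) {x : S}
    (hrank : ∀ᶠ s in 𝓝 x,
      Module.finrank ℂ ↥(A s ⊓ B s) = Module.finrank ℂ ↥(A x ⊓ B x))
    {v : L.fiber x} (hv : v ∈ A x ⊓ B x) :
    ∃ σ : ∀ s, L.fiber s, σ x = v ∧
      ∀ᶠ s in 𝓝 x, L.HolomorphicAt E σ s ∧ σ s ∈ A s ⊓ B s := by
  classical
  obtain ⟨O, hO, hxO, k, e, he, hfr⟩ := hA x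
  obtain ⟨g, hg⟩ := LinearMap.exists_leftInverse_of_injective
    (Fintype.linearCombination ℂ fun i => e i x)
    (LinearMap.ker_eq_bot.2
      (linearIndependent_iff_injective_fintypeLinearCombination.1 (hfr x hxO).1))
  -- A holomorphic family of endomorphisms of the fixed fibre, with image in the transport of A_s,
  -- and the identity on A_x when s = x.
  let Γ : S → L.fiber x →ₗ[ℂ] L.fiber x := fun s =>
    Fintype.linearCombination ℂ (fun i => L.transport x s (e i s)) ∘ₗ g
  have hΓx : ∀ w ∈ A x, Γ x w = w := by
    intro w hw
    rw [← (hfr x hxO).2, ← Fintype.range_linearCombination ℂ] at hw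
    obtain ⟨a, rfl⟩ := hw
    have := LinearMap.congr_fun hg a
    simp only [LinearMap.comp_apply, LinearMap.id_apply] at this
    simp only [Γ, LinearMap.comp_apply, this, L.transport_self, LinearMap.id_apply]
  have hΓmem : ∀ s ∈ O, ∀ w, Γ s w ∈ (A s).map (L.transport x s) := by
    intro s hs w
    simp only [Γ, LinearMap.comp_apply, Fintype.linearCombination_apply]
    refine Submodule.sum_mem _ fun i _ => Submodule.smul_mem _ _ (Submodule.mem_map_of_mem ?_)
    rw [← (hfr s hs).2]
    exact Submodule.subset_span ⟨i, rfl⟩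
  obtain ⟨C, hCd, hCs⟩ : ∃ C, Disjoint (A x ⊓ B x) C ∧ (A x ⊓ B x) ⊔ C = A x := by
    obtain ⟨C, hC1, hC2⟩ := IsModularLattice.exists_disjoint_and_sup_eq
      (inf_le_left : A x ⊓ B x ≤ A x)
    exact ⟨C, hC1, hC2⟩
  have hCA : C ≤ A x := le_sup_right.trans hCs.le
  have hCB : Disjoint C (B x) := by
    rw [disjoint_iff, ← le_bot_iff, ← hCd.eq_bot]
    exact le_inf (inf_le_inf hCA le_rfl) inf_le_left
  -- B_x is enlarged to a complement Q of C. As C ⊆ A_x, the subspaces A_x and Q span the fibre, so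
  -- intersecting with Q behaves well nearby even when A_x and B_x do not span.
  obtain ⟨Q, hBQ, hQC⟩ := hCB.symm.exists_isCompl
  have hCQ := hQC.symm
  let π : L.fiber x →ₗ[ℂ] L.fiber x := C.projection Q hCQ
  have hπC : ∀ w, π w ∈ C := fun w => Submodule.projection_apply_mem hCQ w
  have hπid : ∀ c ∈ C, π c = c := fun c hc => Submodule.projection_apply_of_mem_left hCQ hc
  have hπQ : ∀ w, w - π w ∈ Q := fun w => Submodule.sub_projection_mem hCQ w
  have hπ0 : ∀ w ∈ Q, π w = 0 := fun w hw => (Submodule.projection_apply_eq_zero_iff hCQ).2 hw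
  -- The identity on Q and Γ_s on C, hence the identity at x and invertible nearby.
  let Φ : S → L.fiber x →ₗ[ℂ] L.fiber x := fun s => (LinearMap.id - π) + Γ s ∘ₗ π
  have hΦ : ∀ s w, Φ s w = (w - π w) + Γ s (π w) := fun s w => rfl
  have hΦx : Φ x = LinearMap.id := LinearMap.ext fun w => by
    rw [hΦ, hΓx _ (hCA (hπC w))]
    simp
  have hreg : ∀ᶠ s in 𝓝 x, ∀ w, RegularAt ℂ E ω (fun t => Γ t w) s := by
    filter_upwards [L.eventually_regularAt_iff (𝕜 := ℂ) (E := E) (n := ω) x, hO.mem_nhds hxO]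
      with s hs hsO w
    exact regularAt_linearCombination (fun i => (hs (e i)).1 (he i s hsO)) (g w)
  have hregΦ : ∀ᶠ s in 𝓝 x, ∀ w, RegularAt ℂ E ω (fun t => Φ t w) s := by
    filter_upwards [hreg] with s hs w
    exact (RegularAt.const _).add (hs (π w))
  have hbij : ∀ᶠ s in 𝓝 x, Function.Bijective (Φ s) := by
    obtain ⟨Ψ, -, hΨ⟩ := exists_regularAt_inverse hregΦ.self_of_nhds
      (by rw [hΦx]; exact Function.bijective_id)
    filter_upwards [hΨ] with s hs
    exact Function.bijective_iff_has_inverse.2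
      ⟨Ψ s, LinearMap.congr_fun hs.1, LinearMap.congr_fun hs.2⟩
  -- This corrects Γ_s v to land in Q: f is the Q-component of z, and f = Γ_s v - Γ_s(π z) stays in
  -- the transport of A_s.
  let z : S → L.fiber x := fun s => Function.invFun (Φ s) (Γ s v)
  let f : S → L.fiber x := fun s => z s - π (z s)
  have hz : ∀ s, Function.Bijective (Φ s) → Φ s (z s) = Γ s v := fun s hs =>
    Function.rightInverse_invFun hs.surjective _
  have hfreg : ∀ᶠ s in 𝓝 x, RegularAt ℂ E ω f s := by
    filter_upwards [hreg, hregΦ, hbij] with s h1 h2 h3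
    obtain ⟨Ψ, hΨ, hΨ'⟩ := exists_regularAt_inverse h2 h3
    have hzr : RegularAt ℂ E ω z s := by
      refine (RegularAt.apply hΨ (h1 v)).congr ?_
      filter_upwards [hΨ'] with t ht
      have hb : Function.Bijective (Φ t) := Function.bijective_iff_has_inverse.2
        ⟨Ψ t, LinearMap.congr_fun ht.1, LinearMap.congr_fun ht.2⟩
      rw [← hz t hb]
      exact (LinearMap.congr_fun ht.1 (z t)).symm
    exact hzr.sub (hzr.map π)
  have hvC : π v = 0 := hπ0 v (hBQ hv.2)
  have hzx : z x = v := by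
    have := hz x (by rw [hΦx]; exact Function.bijective_id)
    rwa [hΦx, hΓx v hv.1] at this
  have hfx : f x = v := by
    simp only [f, hzx, hvC, sub_zero]
  have hfmem : ∀ᶠ s in 𝓝 x, f s ∈ ((A s).map (L.transport x s)) ⊓ B x := by
    have hd1 := L.eventually_finrank_of_isHolomorphicSubbundle hA x
    filter_upwards [hbij, hO.mem_nhds hxO, hrank, hd1, hB x, L.transport_bijective x]
      with s hs hsO hr hd hBs hT
    set A' := (A s).map (L.transport x s) with hA'
    have hfQ : f s ∈ Q := hπQ _
    have hfA : f s ∈ A' := by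
      have h1 : f s = Γ s v - Γ s (π (z s)) := by
        rw [← hz s hs, hΦ]
        simp [f]
      rw [h1]
      exact sub_mem (hΓmem s hsO _) (hΓmem s hsO _)
    have hdA : Module.finrank ℂ A' = Module.finrank ℂ (A x) := by
      rw [hA', ← (Submodule.equivMapOfInjective _ hT.injective (A s)).finrank_eq, hd]
    have hdAB : Module.finrank ℂ ↥(A' ⊓ B x) = Module.finrank ℂ ↥(A x ⊓ B x) := by
      rw [← hBs, hA', ← Submodule.map_inf _ hT.injective,
        ← (Submodule.equivMapOfInjective _ hT.injective _).finrank_eq, hr, hBs]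
    have hΓC : ∀ c ∈ C, Γ s c = Φ s c := fun c hc => by
      rw [hΦ, hπid c hc, sub_self, zero_add]
    have hdC : Module.finrank ℂ (C.map (Φ s)) = Module.finrank ℂ C :=
      (Submodule.equivMapOfInjective _ hs.injective C).finrank_eq.symm
    have hCA' : C.map (Φ s) ≤ A' := by
      rintro _ ⟨c, hc, rfl⟩
      rw [← hΓC c hc]
      exact hΓmem s hsO c
    have hdisj : A' ⊓ Q ⊓ C.map (Φ s) = ⊥ := by
      rw [eq_bot_iff]
      rintro _ ⟨⟨-, hq⟩, c, hc, rfl⟩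
      have h1 : Φ s (Φ s c) = Φ s c := by
        conv_lhs => rw [hΦ, hπ0 _ hq, map_zero, sub_zero, add_zero]
      have h2 : c ∈ Q := by
        rw [← hs.injective h1]
        exact hq
      have h3 : c = 0 := by rw [← hπid c hc, hπ0 c h2]
      simp [h3]
    -- Hence dim(A' ∩ Q) ≤ dim A_x - dim C = dim(A_x ∩ B_x), which by constancy of the rank is
    -- dim(A' ∩ B_x). The inclusion A' ∩ B_x ⊆ A' ∩ Q is thus an equality, and f lies in B_x.
    have hle : Module.finrank ℂ ↥(A' ⊓ Q) + Module.finrank ℂ C ≤ Module.finrank ℂ A' := by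
      have := Submodule.finrank_sup_add_finrank_inf_eq (A' ⊓ Q) (C.map (Φ s))
      rw [hdisj, finrank_bot, add_zero, hdC] at this
      rw [← this]
      exact Submodule.finrank_mono (sup_le inf_le_left hCA')
    have hsum : Module.finrank ℂ (A x) =
        Module.finrank ℂ ↥(A x ⊓ B x) + Module.finrank ℂ C := by
      have := Submodule.finrank_sup_add_finrank_inf_eq (A x ⊓ B x) C
      rwa [hCd.eq_bot, finrank_bot, add_zero, hCs] at this
    have heq : A' ⊓ B x = A' ⊓ Q :=
      Submodule.eq_of_le_of_finrank_le (inf_le_inf le_rfl hBQ) (by omega)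
    rw [heq]
    exact ⟨hfA, hfQ⟩
  refine ⟨L.lift x f, by rw [lift_self, hfx], ?_⟩
  filter_upwards [hfreg, hfmem, L.eventually_regularAt_lift (𝕜 := ℂ) (E := E) (n := ω) x,
    L.eventually_transport_lift x, hB x, L.transport_bijective x] with s h1 h2 h3 h4 h5 h6
  refine ⟨h3 f h1, ?_⟩
  rw [← h4 f, ← h5, ← Submodule.map_inf _ h6.injective] at h2
  obtain ⟨y, hy, hy'⟩ := h2
  rwa [← h6.injective hy']

end Extension

end LocalSystem

/-! ## Adapted frames -/

namespace Hodge

theorem baseChange_range {M H : Type*} [AddCommGroup M] [Module ℚ M] [AddCommGroup H] [Module ℚ H]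
    (f : M →ₗ[ℚ] H) :
    (LinearMap.range f).baseChange ℂ = LinearMap.range (f.baseChange ℂ) := by
  have h : f = (LinearMap.range f).subtype ∘ₗ f.rangeRestrict := rfl
  conv_rhs => rw [h, LinearMap.baseChange_comp]
  rw [LinearMap.range_comp_of_range_eq_top, baseChange_eq_range]
  exact LinearMap.range_eq_top.2 (LinearMap.lTensor_surjective ℂ f.surjective_rangeRestrict)

theorem map_baseChange {H H' : Type*} [AddCommGroup H] [Module ℚ H] [AddCommGroup H'] [Module ℚ H']
    (f : H →ₗ[ℚ] H') (A : Submodule ℚ H) :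
    (A.baseChange ℂ).map (f.baseChange ℂ) = (A.map f).baseChange ℂ := by
  rw [baseChange_eq_range, ← LinearMap.range_comp, ← LinearMap.baseChange_comp,
    ← baseChange_range, LinearMap.range_comp, Submodule.range_subtype]

end Hodge

theorem LocalSystem.isFlatSub_baseChange {S : Type u} [TopologicalSpace S]
    (L : LocalSystem.{u, v, 0} ℚ S) {A : ∀ s, Submodule ℚ (L.fiber s)} (hA : L.IsFlatSub A) :
    L.complexify.IsFlatSub fun s => (A s).baseChange ℂ := by
  intro x
  filter_upwards [hA x] with s hs
  rw [← hs]
  exact Hodge.map_baseChange _ _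

namespace VGPMHS

variable {E : Type w} [NormedAddCommGroup E] [NormedSpace ℂ E]
  {S : Type u} [TopologicalSpace S] [ChartedSpace E S] (V : VGPMHS.{u, v, w} E S)

/-- The complexified weight filtration. -/
def WC (k : ℤ) (s : S) : Submodule ℂ (V.VQ.complexify.fiber s) := (V.W k s).baseChange ℂ

theorem isMixedHodge (s : S) : IsMixedHodge (Hodge.conjIso (V.VQ.fiber s))
    (fun p => V.F p s) fun k => V.WC k s :=
  Hodge.isMixedHodge (V.W_mono s) (V.W_exists_eq_bot s) (V.W_exists_eq_top s) (V.F_anti s)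
    (V.F_exists_eq_top s) (V.F_exists_eq_bot s) fun k => (V.graded k).pure s

theorem eventually_finrank_F (p : ℤ) (x : S) :
    ∀ᶠ s in 𝓝 x, Module.finrank ℂ (V.F p s) = Module.finrank ℂ (V.F p x) :=
  V.VQ.complexify.eventually_finrank_of_isHolomorphicSubbundle (V.F_holomorphic p) x

/-- Induction on k: passing from W_{k-1} to W_k adds the rank of F^p Gr^W_k, which is locally
constant because it is a holomorphic subbundle of the graded local system. -/
theorem eventually_finrank_F_inf_WC (p k : ℤ) (x : S) :
    ∀ᶠ s in 𝓝 x, Module.finrank ℂ ↥(V.F p s ⊓ V.WC k s) =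
      Module.finrank ℂ ↥(V.F p x ⊓ V.WC k x) := by
  obtain ⟨m, hm⟩ := V.W_exists_eq_bot x
  have hbot : ∀ᶠ s in 𝓝 x, V.W m s = ⊥ := by
    filter_upwards [V.W_flat m x, V.VQ.transport_bijective x] with s hs hb
    rw [hm] at hs
    exact (Submodule.eq_bot_iff _).2 fun w hw => hb.injective <| by
      rw [map_zero, ← Submodule.mem_bot ℚ, ← hs]
      exact Submodule.mem_map_of_mem hw
  have hWC : ∀ {k s}, V.W k s = ⊥ → V.WC k s = ⊥ := fun h => by
    rw [WC, h, Submodule.baseChange_bot]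
  have key : ∀ n : ℕ, ∀ᶠ s in 𝓝 x, Module.finrank ℂ ↥(V.F p s ⊓ V.WC (m + n) s) =
      Module.finrank ℂ ↥(V.F p x ⊓ V.WC (m + n) x) := by
    intro n
    induction n with
    | zero =>
      filter_upwards [hbot] with s hs
      rw [Nat.cast_zero, add_zero, hWC hs, hWC hm, inf_bot_eq, inf_bot_eq, finrank_bot, finrank_bot]
    | succ n ih =>
      have hgr := LocalSystem.eventually_finrank_of_isHolomorphicSubbundle _
        ((V.graded (m + (n + 1 : ℕ))).holomorphic p) x
      have e : m + (n + 1 : ℕ) - 1 = m + n := by push_cast; ring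
      rw [← e] at ih
      filter_upwards [hgr, ih] with s h1 h2
      have hle : ∀ s, V.W (m + (n + 1 : ℕ) - 1) s ≤ V.W (m + (n + 1 : ℕ)) s :=
        fun s => V.W_mono s (by omega)
      have h3 := Hodge.finrank_inducedFiltration (hle s) (V.F p s)
      have h4 := Hodge.finrank_inducedFiltration (hle x) (V.F p x)
      exact h3.trans ((congrArg₂ (· + ·) h1 h2).trans h4.symm)
  rcases le_total k m with hk | hk
  · filter_upwards [hbot] with s hs
    have h1 : V.W k s = ⊥ := le_bot_iff.1 ((V.W_mono s hk).trans hs.le)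
    have h2 : V.W k x = ⊥ := le_bot_iff.1 ((V.W_mono x hk).trans hm.le)
    rw [hWC h1, hWC h2, inf_bot_eq, inf_bot_eq, finrank_bot, finrank_bot]
  · have := key (k - m).toNat
    rwa [show m + ((k - m).toNat : ℤ) = k by omega] at this

/-- Vectors in `F^p ∩ W_k` extend to local holomorphic sections. -/
theorem exists_extension (p k : ℤ) {x : S} {v : V.VQ.complexify.fiber x}
    (hv : v ∈ V.F p x ⊓ V.WC k x) :
    ∃ σ : ∀ s, V.VQ.complexify.fiber s, σ x = v ∧ ∀ᶠ s in 𝓝 x,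
      V.VQ.complexify.HolomorphicAt E σ s ∧ σ s ∈ V.F p s ⊓ V.WC k s :=
  V.VQ.complexify.exists_holomorphic_extension (V.F_holomorphic p)
    (V.VQ.isFlatSub_baseChange (V.W_flat k)) (V.eventually_finrank_F_inf_WC p k x) hv

/-- A family of bigradings of the fibers. -/
def IsBigrading (I : ∀ s, ℤ × ℤ → Submodule ℂ (V.VQ.complexify.fiber s)) : Prop :=
  ∀ s, _root_.IsBigrading (Hodge.conjIso (V.VQ.fiber s)) (fun p => V.F p s) (fun k => V.WC k s)
    (I s)

/-- The increasing filtration `⊕_{r ≤ p} I^{r,t}` opposed to the Hodge filtration. -/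
def opposed (I : ∀ s, ℤ × ℤ → Submodule ℂ (V.VQ.complexify.fiber s)) (p : ℤ) (s : S) :
    Submodule ℂ (V.VQ.complexify.fiber s) := supOver (I s) {i | i.1 ≤ p}

/-- A local frame adapted to the Hodge and weight filtrations and to the bigrading at `x`. -/
structure AdaptedFrame (I : ∀ s, ℤ × ℤ → Submodule ℂ (V.VQ.complexify.fiber s)) (x : S) where
  ι : Type
  [fintype : Fintype ι]
  deg : ι → ℤ × ℤ
  sec : ι → ∀ s, V.VQ.complexify.fiber s
  holomorphic : ∀ i, ∀ᶠ s in 𝓝 x, V.VQ.complexify.HolomorphicAt E (sec i) s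
  mem_F : ∀ i, ∀ᶠ s in 𝓝 x, sec i s ∈ V.F (deg i).1 s
  mem_W : ∀ i, ∀ᶠ s in 𝓝 x, sec i s ∈ V.WC ((deg i).1 + (deg i).2) s
  linearIndependent : LinearIndependent ℂ fun i => sec i x
  span_eq : ∀ Λ : Set (ℤ × ℤ),
    Submodule.span ℂ (Set.range fun i : {i // deg i ∈ Λ} => sec i x) = supOver (I x) Λ

attribute [instance] AdaptedFrame.fintype

variable {V} {I : ∀ s, ℤ × ℤ → Submodule ℂ (V.VQ.complexify.fiber s)}

theorem IsBigrading.isCompl (hI : V.IsBigrading I) {p q : ℤ} (h : q + 1 = p) (s : S) :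
    IsCompl (V.F p s) (V.opposed I q s) := by
  obtain ⟨M, hM⟩ := (V.isMixedHodge s).weight_top
  exact (hI s).isCompl hM h

theorem IsBigrading.isInternal (hI : V.IsBigrading I) (s : S) :
    DirectSum.IsInternal (I s) := by
  rw [DirectSum.isInternal_submodule_iff_iSupIndep_and_iSup_eq_top]
  obtain ⟨M, hM⟩ := (V.isMixedHodge s).weight_top
  refine ⟨(hI s).indep, ?_⟩
  simpa [supOver] using (hI s).supOver_univ hM

theorem IsBigrading.le_F_inf_WC (hI : V.IsBigrading I) (s : S) (i : ℤ × ℤ) :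
    I s i ≤ V.F i.1 s ⊓ V.WC (i.1 + i.2) s := by
  have h1 := (hI s).hodge i.1
  have h2 := (hI s).weight (i.1 + i.2)
  rw [h1, h2]
  exact le_inf (le_supOver (Λ := {j : ℤ × ℤ | i.1 ≤ j.1}) (le_refl i.1))
    (le_supOver (Λ := {j : ℤ × ℤ | j.1 + j.2 ≤ i.1 + i.2}) (le_refl (i.1 + i.2)))

/-- Each vector of a basis of I^{p,q} at x is extended inside F^p ∩ W_{p+q}. The extensions are tied
to the bigrading at x only. -/
theorem IsBigrading.exists_adaptedFrame (hI : V.IsBigrading I) (x : S) :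
    Nonempty (V.AdaptedFrame I x) := by
  classical
  let b := (hI.isInternal x).collectedBasis fun i => Module.finBasis ℂ (I x i)
  have hb : ∀ i, b i ∈ I x i.1 := fun i => (hI.isInternal x).collectedBasis_mem _ i
  let _ : Fintype ((i : ℤ × ℤ) × Fin (Module.finrank ℂ (I x i))) :=
    FiniteDimensional.fintypeBasisIndex b
  choose e hex he using fun i => V.exists_extension _ _ (hI.le_F_inf_WC x _ (hb i))
  have hex' : (fun i => e i x) = b := funext hex
  refine ⟨{ ι := _, deg := Sigma.fst, sec := e
            holomorphic := fun i => (he i).mono fun s hs => hs.1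
            mem_F := fun i => (he i).mono fun s hs => hs.2.1
            mem_W := fun i => (he i).mono fun s hs => hs.2.2
            linearIndependent := by rw [hex']; exact b.linearIndependent
            span_eq := fun Λ => le_antisymm ?_ ?_ }⟩
  · rw [Submodule.span_le]
    rintro _ ⟨⟨i, hi⟩, rfl⟩
    dsimp only
    rw [hex i]
    exact (le_supOver hi : I x i.1 ≤ supOver (I x) Λ) (hb i)
  · refine supOver_le fun j hj w hw => ?_
    have h1 : w = ∑ k, (Module.finBasis ℂ (I x j)).repr ⟨w, hw⟩ k • b ⟨j, k⟩ := by
      have := congrArg Subtype.val ((Module.finBasis ℂ (I x j)).sum_repr ⟨w, hw⟩)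
      simp only [Submodule.coe_sum, Submodule.coe_smul] at this
      refine this.symm.trans (Finset.sum_congr rfl fun k _ => ?_)
      simp [b, DirectSum.IsInternal.collectedBasis_coe]
    rw [h1]
    refine Submodule.sum_mem _ fun k _ => Submodule.smul_mem _ _ (Submodule.subset_span ?_)
    exact ⟨⟨⟨j, k⟩, hj⟩, hex _⟩

namespace AdaptedFrame

variable {x : S} (f : V.AdaptedFrame I x)

theorem smoothAt (i : f.ι) : V.VQ.complexify.SmoothAt E (f.sec i) x :=
  V.VQ.complexify.smoothAt_of_holomorphicAt (f.holomorphic i).self_of_nhds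

theorem linearIndependent_subtype (P : f.ι → Prop) :
    LinearIndependent ℂ fun i : {i // P i} => f.sec i x :=
  f.linearIndependent.comp _ Subtype.val_injective

theorem linearIndependent_conj (P : f.ι → Prop) :
    LinearIndependent ℂ fun i : {i // P i} => V.VQ.conjSection (f.sec i) x :=
  (f.linearIndependent_subtype P).map_of_injective_injective (starRingEnd ℂ)
    (Hodge.conj (V.VQ.fiber x)).toAddMonoidHom (by simp)
    (fun m hm => by
      have : Hodge.conj (V.VQ.fiber x) m = 0 := hm
      simpa using congrArg (Hodge.conj (V.VQ.fiber x)) this)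
    (fun r m => by simp [map_smulₛₗ])

/-- The Hodge filtration is spanned by the sections of the frame of sufficiently high degree. -/
theorem eventually_span_F (hI : V.IsBigrading I) (p : ℤ) :
    ∀ᶠ s in 𝓝 x,
      Submodule.span ℂ (Set.range fun i : {i // p ≤ (f.deg i).1} => f.sec i s) = V.F p s := by
  have h0 := (f.span_eq {i | p ≤ i.1}).trans ((hI x).hodge p).symm
  have h1 := V.VQ.complexify.eventually_linearIndependent
    (fun i : {i // p ≤ (f.deg i).1} => f.smoothAt i) (f.linearIndependent_subtype _)
  have h2 : ∀ᶠ s in 𝓝 x, ∀ i, f.sec i s ∈ V.F (f.deg i).1 s := eventually_all.2 f.mem_F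
  filter_upwards [h1, h2, V.eventually_finrank_F p x] with s h3 h4 h5
  refine Submodule.eq_of_le_of_finrank_eq (Submodule.span_le.2 ?_) ?_
  · rintro _ ⟨i, rfl⟩
    exact V.F_anti s i.2 (h4 i)
  · rw [h5, ← h0, finrank_span_eq_card h3]
    exact (finrank_span_eq_card (f.linearIndependent_subtype _)).symm

/-- The opposed filtration is spanned by conjugates of sections of the frame. -/
theorem eventually_span_opposed (hI : V.IsBigrading I) (p : ℤ) :
    ∀ᶠ s in 𝓝 x,
      Submodule.span ℂ (Set.range fun i : {i // (f.deg i).2 ≤ p} =>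
        V.VQ.conjSection (f.sec i) s) = V.opposed I p s := by
  have h0 : Submodule.span ℂ (Set.range fun i : {i // (f.deg i).2 ≤ p} =>
      V.VQ.conjSection (f.sec i) x) = V.opposed I p x := by
    obtain ⟨m, hm⟩ := (V.isMixedHodge x).weight_bot
    rw [opposed, ← (hI x).conj_snd_le hm, ← f.span_eq {i | i.2 ≤ p}, Hodge.conjIso_apply,
      Hodge.conjSub, Submodule.map_span, ← Set.range_comp]
    rfl
  have h1 := V.VQ.complexify.eventually_linearIndependent
    (fun i : {i // (f.deg i).2 ≤ p} => V.VQ.smoothAt_conjSection (f.smoothAt i))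
    (f.linearIndependent_conj _)
  have h2 : ∀ᶠ s in 𝓝 x, ∀ i, f.sec i s ∈ V.F (f.deg i).1 s := eventually_all.2 f.mem_F
  have h2' : ∀ᶠ s in 𝓝 x, ∀ i, f.sec i s ∈ V.WC ((f.deg i).1 + (f.deg i).2) s :=
    eventually_all.2 f.mem_W
  filter_upwards [h1, h2, h2', V.eventually_finrank_F (p + 1) x,
    V.VQ.complexify.eventually_finrank_eq x] with s h3 h4 h4' h5 h6
  refine Submodule.eq_of_le_of_finrank_eq (Submodule.span_le.2 ?_) ?_
  · rintro _ ⟨i, rfl⟩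
    obtain ⟨m, hm⟩ := (V.isMixedHodge s).weight_bot
    -- A section of degree (a, b) lies in F^a ∩ W_{a+b}, and b ≤ p puts its conjugate in the opposed
    -- filtration at s, not only at x.
    refine (hI s).conj_hodge_inf_le hm (V.isMixedHodge s).conj_weight (a := (f.deg i).1)
      (k := (f.deg i).1 + (f.deg i).2) (by have := i.2; omega) ⟨?_, ?_⟩
    · exact Hodge.conj_mem_conjSub (h4 i)
    · exact Hodge.conj_mem_baseChange (h4' i)
  -- The opposed filtration is a complement of F^{p+1}, so its rank is locally constant.
  · have d1 := Submodule.finrank_add_eq_of_isCompl (hI.isCompl (rfl : p + 1 = p + 1) s)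
    have d2 := Submodule.finrank_add_eq_of_isCompl (hI.isCompl (rfl : p + 1 = p + 1) x)
    have d3 : Module.finrank ℂ (V.opposed I p s) = Module.finrank ℂ (V.opposed I p x) :=
      Nat.add_left_cancel ((congrArg (· + _) h5.symm).trans (d1.trans (h6.trans d2.symm)))
    rw [d3, ← h0, finrank_span_eq_card h3]
    exact (finrank_span_eq_card (f.linearIndependent_conj _)).symm

end AdaptedFrame

end VGPMHS

/-! ## Complex linear and antilinear parts of real linear maps -/

section Parts

variable {E : Type*} [AddCommGroup E] [Module ℂ E] {M : Type*} [AddCommGroup M] [Module ℂ M]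

/-- The conjugate linear part of a real linear map. -/
def antilinearPart (α : E →ₗ[ℝ] M) : E →ₗ[ℝ] M where
  toFun ξ := (1 / 2 : ℂ) • (α ξ + Complex.I • α (Complex.I • ξ))
  map_add' ξ η := by simp only [smul_add, map_add]; abel
  map_smul' r ξ := by
    simp only [smul_comm Complex.I r, map_smul, smul_add, RingHom.id_apply, smul_comm _ r]

/-- The complex linear part of a real linear map. -/
def linearPart (α : E →ₗ[ℝ] M) : E →ₗ[ℝ] M where
  toFun ξ := (1 / 2 : ℂ) • (α ξ - Complex.I • α (Complex.I • ξ))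
  map_add' ξ η := by simp only [smul_add, map_add, smul_sub]; abel
  map_smul' r ξ := by
    simp only [smul_comm Complex.I r, map_smul, smul_sub, RingHom.id_apply, smul_comm _ r]

theorem antilinearPart_apply (α : E →ₗ[ℝ] M) (ξ : E) :
    antilinearPart α ξ = (1 / 2 : ℂ) • (α ξ + Complex.I • α (Complex.I • ξ)) := rfl

theorem linearPart_apply (α : E →ₗ[ℝ] M) (ξ : E) :
    linearPart α ξ = (1 / 2 : ℂ) • (α ξ - Complex.I • α (Complex.I • ξ)) := rfl

theorem antilinearPart_add_linearPart (α : E →ₗ[ℝ] M) (ξ : E) :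
    antilinearPart α ξ + linearPart α ξ = α ξ := by
  rw [antilinearPart_apply, linearPart_apply]
  module

theorem map_complex_smul (α : E →ₗ[ℝ] M) (c : ℂ) (ξ : E) :
    α (c • ξ) = (c.re : ℂ) • α ξ + (c.im : ℂ) • α (Complex.I • ξ) := by
  conv_lhs => rw [← Complex.re_add_im c, add_smul, mul_smul, map_add]
  have h : ∀ (r : ℝ) (η : E), α ((r : ℂ) • η) = (r : ℂ) • α η := fun r η => by
    rw [Complex.coe_smul, Complex.coe_smul, map_smul]
  rw [h, h]

theorem antilinearPart_smul (α : E →ₗ[ℝ] M) (c : ℂ) (ξ : E) :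
    antilinearPart α (c • ξ) = starRingEnd ℂ c • antilinearPart α ξ := by
  have h : antilinearPart α (Complex.I • ξ) = (-Complex.I) • antilinearPart α ξ := by
    simp only [antilinearPart_apply, smul_smul Complex.I Complex.I, Complex.I_mul_I, neg_smul,
      one_smul, map_neg, smul_add, smul_neg, smul_comm (1 / 2 : ℂ) Complex.I]
    module
  rw [map_complex_smul, h, smul_smul, ← add_smul]
  congr 1
  apply Complex.ext <;> simp

theorem linearPart_smul (α : E →ₗ[ℝ] M) (c : ℂ) (ξ : E) :
    linearPart α (c • ξ) = c • linearPart α ξ := by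
  have h : linearPart α (Complex.I • ξ) = Complex.I • linearPart α ξ := by
    simp only [linearPart_apply, smul_smul Complex.I Complex.I, Complex.I_mul_I, neg_smul,
      one_smul, map_neg, smul_sub, smul_neg, smul_comm (1 / 2 : ℂ) Complex.I]
    module
  rw [map_complex_smul, h, smul_smul, ← add_smul, Complex.re_add_im]

/-- The antilinear part is a multiple of the failure of complex linearity, and in `linearPart_mem`
the linear part is a multiple of the failure of antilinearity. So only these defects need
estimating. -/
theorem antilinearPart_mem {α : E →ₗ[ℝ] M} {A : Submodule ℂ M} {ξ : E}
    (h : α (Complex.I • ξ) - Complex.I • α ξ ∈ A) : antilinearPart α ξ ∈ A := by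
  have : antilinearPart α ξ =
      (Complex.I / 2) • (α (Complex.I • ξ) - Complex.I • α ξ) := by
    rw [antilinearPart_apply, smul_sub, smul_smul, div_mul_eq_mul_div, Complex.I_mul_I]
    module
  rw [this]
  exact A.smul_mem _ h

theorem linearPart_mem {α : E →ₗ[ℝ] M} {A : Submodule ℂ M} {ξ : E}
    (h : α (Complex.I • ξ) + Complex.I • α ξ ∈ A) : linearPart α ξ ∈ A := by
  have : linearPart α ξ =
      (-Complex.I / 2) • (α (Complex.I • ξ) + Complex.I • α ξ) := by
    rw [linearPart_apply, smul_add, smul_smul, div_mul_eq_mul_div, neg_mul, Complex.I_mul_I]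
    module
  rw [this]
  exact A.smul_mem _ h

theorem antilinearPart_mem_of_forall {α : E →ₗ[ℝ] M} {A : Submodule ℂ M} (h : ∀ ξ, α ξ ∈ A)
    (ξ : E) : antilinearPart α ξ ∈ A :=
  antilinearPart_mem (A.sub_mem (h _) (A.smul_mem _ (h _)))

theorem linearPart_mem_of_forall {α : E →ₗ[ℝ] M} {A : Submodule ℂ M} (h : ∀ ξ, α ξ ∈ A)
    (ξ : E) : linearPart α ξ ∈ A :=
  linearPart_mem (A.add_mem (h _) (A.smul_mem _ (h _)))

end Parts

/-! ### Local coefficients and the type decomposition of smooth forms. -/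

namespace LocalSystem

section Forms

variable {S : Type u} [TopologicalSpace S] (L : LocalSystem.{u, v, 0} ℂ S)

/-- The coefficients are chosen pointwise; their regularity comes afterwards from
`coeff_mem_regularFunctions`. -/
theorem exists_coeff {κ : Type*} [Fintype κ] {b : κ → ∀ s, L.fiber s} {σ : ∀ s, L.fiber s} {x : S}
    (h : ∀ᶠ s in 𝓝 x, σ s ∈ Submodule.span ℂ (Set.range fun k => b k s)) :
    ∃ c : κ → S → ℂ, ∀ᶠ s in 𝓝 x, σ s = ∑ k, c k s • b k s := by
  have : ∀ᶠ s in 𝓝 x, ∃ c : κ → ℂ, σ s = ∑ k, c k • b k s := by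
    filter_upwards [h] with s hs
    obtain ⟨c, hc⟩ := (Submodule.mem_span_range_iff_exists_fun ℂ).1 hs
    exact ⟨c, hc.symm⟩
  obtain ⟨c, hc⟩ := this.choice
  exact ⟨fun k s => c s k, hc⟩

variable {E : Type w} [NormedAddCommGroup E] [NormedSpace ℂ E] [ChartedSpace E S]
  [IsManifold 𝓘(ℂ, E) ω S] {L} {α : ∀ s : S, E →ₗ[ℝ] L.fiber s} {x : S}

theorem SmoothFormAt.rotate (h : L.SmoothFormAt E α x) (v : E) :
    L.SmoothAt E (fun s => Complex.I • α s (Complex.I • tangentCoordChange 𝓘(ℂ, E) x s s v)) x := by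
  intro l
  refine regularFunctions_congr
    (mul_mem (Subalgebra.algebraMap_mem _ Complex.I) (h (Complex.I • v) l)) ?_
  refine Eventually.of_forall fun s => ?_
  simp only [map_smul]
  rfl

theorem SmoothFormAt.antilinearPart (h : L.SmoothFormAt E α x) :
    L.SmoothFormAt E (fun s => _root_.antilinearPart (α s)) x := by
  intro v l
  refine regularFunctions_congr
    (mul_mem (Subalgebra.algebraMap_mem _ (1 / 2 : ℂ)) (add_mem (h v l) (h.rotate v l))) ?_
  refine Eventually.of_forall fun s => ?_
  simp only [antilinearPart_apply, map_smul, map_add]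
  rfl

theorem SmoothFormAt.linearPart (h : L.SmoothFormAt E α x) :
    L.SmoothFormAt E (fun s => _root_.linearPart (α s)) x := by
  intro v l
  refine regularFunctions_congr
    (mul_mem (Subalgebra.algebraMap_mem _ (1 / 2 : ℂ)) (sub_mem (h v l) (h.rotate v l))) ?_
  refine Eventually.of_forall fun s => ?_
  simp only [linearPart_apply, map_smul, map_sub]
  rfl

end Forms

end LocalSystem

/-! ## The Hodge bundles -/

namespace VGPMHS

variable {E : Type w} [NormedAddCommGroup E] [NormedSpace ℂ E]
  {S : Type u} [TopologicalSpace S] [ChartedSpace E S] {V : VGPMHS.{u, v, w} E S}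
  {I : ∀ s, ℤ × ℤ → Submodule ℂ (V.VQ.complexify.fiber s)}

variable (V I) in
/-- The Hodge bundle `U^p = ⊕_q I^{p,q}`. -/
def hodgeBundle (p : ℤ) (s : S) : Submodule ℂ (V.VQ.complexify.fiber s) :=
  supOver (I s) {i | i.1 = p}

namespace IsBigrading

theorem F_inf_opposed (hI : V.IsBigrading I) (p : ℤ) (s : S) :
    V.F p s ⊓ V.opposed I p s = V.hodgeBundle I p s := by
  refine ((hI s).hodge_inf p p).trans ?_
  congr 1
  ext i
  exact ⟨fun h => le_antisymm h.2 h.1, fun h => ⟨ge_of_eq h, le_of_eq h⟩⟩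

/-- The projection onto `F^p` along the opposed filtration. -/
def proj (hI : V.IsBigrading I) (p : ℤ) (s : S) :
    V.VQ.complexify.fiber s →ₗ[ℂ] V.VQ.complexify.fiber s :=
  (V.F p s).projection (V.opposed I (p - 1) s) (hI.isCompl (sub_add_cancel p 1) s)

/-- The projection onto `U^p`. -/
def component (hI : V.IsBigrading I) (p : ℤ) (s : S) :
    V.VQ.complexify.fiber s →ₗ[ℂ] V.VQ.complexify.fiber s :=
  hI.proj p s - hI.proj (p + 1) s

theorem opposed_mono {p q : ℤ} (h : p ≤ q) (s : S) : V.opposed I p s ≤ V.opposed I q s :=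
  supOver_mono fun _ hi => le_trans hi h

theorem proj_mem (hI : V.IsBigrading I) (p : ℤ) (s : S) (v : V.VQ.complexify.fiber s) :
    hI.proj p s v ∈ V.F p s :=
  Submodule.projection_apply_mem _ _

theorem sub_proj_mem (hI : V.IsBigrading I) (p : ℤ) (s : S) (v : V.VQ.complexify.fiber s) :
    v - hI.proj p s v ∈ V.opposed I (p - 1) s :=
  Submodule.sub_projection_mem _ _

theorem proj_of_mem (hI : V.IsBigrading I) {p : ℤ} {s : S} {v : V.VQ.complexify.fiber s}
    (h : v ∈ V.F p s) : hI.proj p s v = v :=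
  Submodule.projection_apply_of_mem_left _ h

theorem proj_of_mem_opposed (hI : V.IsBigrading I) {p q : ℤ} (hq : q + 1 = p) {s : S}
    {v : V.VQ.complexify.fiber s} (h : v ∈ V.opposed I q s) : hI.proj p s v = 0 := by
  obtain rfl : q = p - 1 := by omega
  exact (Submodule.projection_apply_eq_zero_iff _).2 h

theorem component_mem (hI : V.IsBigrading I) (p : ℤ) (s : S) (v : V.VQ.complexify.fiber s) :
    hI.component p s v ∈ V.hodgeBundle I p s := by
  rw [← hI.F_inf_opposed]
  refine ⟨sub_mem (hI.proj_mem p s v) (V.F_anti s (by omega) (hI.proj_mem (p + 1) s v)), ?_⟩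
  have h1 := hI.sub_proj_mem (p + 1) s v
  have h2 := opposed_mono (by omega : p - 1 ≤ p) s (hI.sub_proj_mem p s v)
  rw [add_sub_cancel_right] at h1
  have := sub_mem h1 h2
  rwa [sub_sub_sub_cancel_left] at this

theorem component_of_mem (hI : V.IsBigrading I) {p : ℤ} {s : S} {v : V.VQ.complexify.fiber s}
    (h : v ∈ V.hodgeBundle I p s) : hI.component p s v = v := by
  rw [← hI.F_inf_opposed] at h
  rw [component, LinearMap.sub_apply, hI.proj_of_mem h.1, hI.proj_of_mem_opposed rfl h.2, sub_zero]

/-- The sum telescopes to `proj p - proj (p + 2)`; the first projection fixes v and the second kills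
it. -/
theorem component_add_component (hI : V.IsBigrading I) {p q : ℤ} (hq : p + 1 = q) {s : S}
    {v : V.VQ.complexify.fiber s} (h : v ∈ V.F p s) (h' : v ∈ V.opposed I q s) :
    hI.component q s v + hI.component p s v = v := by
  subst hq
  rw [component, component, LinearMap.sub_apply, LinearMap.sub_apply, hI.proj_of_mem h,
    hI.proj_of_mem_opposed rfl h']
  abel

/-- Holomorphic sections spanning F^p and conjugate sections spanning the opposed filtration
together form a smooth frame; projecting keeps the first group of coefficients. -/
theorem proj_smoothAt (hI : V.IsBigrading I) (p : ℤ) {σ : ∀ s, V.VQ.complexify.fiber s} {x : S}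
    (hσ : V.VQ.complexify.SmoothAt E σ x) :
    V.VQ.complexify.SmoothAt E (fun s => hI.proj p s (σ s)) x := by
  obtain ⟨f⟩ := hI.exists_adaptedFrame x
  let b : {i // p ≤ (f.deg i).1} ⊕ {i // (f.deg i).2 ≤ p - 1} → ∀ s, V.VQ.complexify.fiber s :=
    Sum.elim (fun i => f.sec i) fun i => V.VQ.conjSection (f.sec i)
  have hb : ∀ k, V.VQ.complexify.SmoothAt E (b k) x :=
    Sum.rec (fun i => f.smoothAt i) fun i => V.VQ.smoothAt_conjSection (f.smoothAt i)
  have hbs : ∀ s, (fun k => b k s) = Sum.elim (fun i : {i // p ≤ (f.deg i).1} => f.sec i s)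
      (fun i : {i // (f.deg i).2 ≤ p - 1} => V.VQ.conjSection (f.sec i) s) := fun s =>
    funext (Sum.rec (fun _ => rfl) fun _ => rfl)
  have h1 := f.eventually_span_F hI p
  have h2 := f.eventually_span_opposed hI (p - 1)
  have hli : LinearIndependent ℂ fun k => b k x := by
    rw [hbs]
    refine (f.linearIndependent_subtype _).sum_type (f.linearIndependent_conj _) ?_
    rw [h1.self_of_nhds, h2.self_of_nhds]
    exact (hI.isCompl (sub_add_cancel p 1) x).disjoint
  obtain ⟨c, hc⟩ := V.VQ.complexify.exists_coeff (b := b) (σ := σ) (x := x) <| by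
    filter_upwards [h1, h2] with s h3 h4
    rw [hbs, Set.Sum.elim_range, Submodule.span_union, h3, h4,
      (hI.isCompl (sub_add_cancel p 1) s).sup_eq_top]
    exact Submodule.mem_top
  have hcr := V.VQ.complexify.coeff_mem_regularFunctions hb hli hσ hc
  refine V.VQ.complexify.regularAt_sum (b := fun i : {i // p ≤ (f.deg i).1} => f.sec i)
    (c := fun i => c (Sum.inl i)) (fun i => f.smoothAt i) (fun i => hcr _) ?_
  filter_upwards [h1, h2, hc] with s h3 h4 hs
  rw [hs, Fintype.sum_sum_type, map_add, map_sum, map_sum]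
  refine (congrArg₂ (· + ·) (Finset.sum_congr rfl fun i _ => ?_)
    (Finset.sum_eq_zero fun i _ => ?_)).trans (add_zero _)
  · refine hI.proj_of_mem (Submodule.smul_mem _ _ ?_)
    rw [← h3]
    exact Submodule.subset_span ⟨i, rfl⟩
  · refine hI.proj_of_mem_opposed (sub_add_cancel p 1) (Submodule.smul_mem _ _ ?_)
    rw [← h4]
    exact Submodule.subset_span ⟨i, rfl⟩

theorem component_smoothAt (hI : V.IsBigrading I) (p : ℤ) {σ : ∀ s, V.VQ.complexify.fiber s}
    {x : S} (hσ : V.VQ.complexify.SmoothAt E σ x) :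
    V.VQ.complexify.SmoothAt E (fun s => hI.component p s (σ s)) x := by
  intro l
  refine regularFunctions_congr (sub_mem (hI.proj_smoothAt p hσ l)
    (hI.proj_smoothAt (p + 1) hσ l)) (Eventually.of_forall fun s => ?_)
  simp only [component, LinearMap.sub_apply, map_sub]
  rfl

theorem finrank_hodgeBundle (hI : V.IsBigrading I) (p : ℤ) (s : S) :
    Module.finrank ℂ (V.hodgeBundle I p s) + Module.finrank ℂ (V.F (p + 1) s) =
      Module.finrank ℂ (V.F p s) := by
  have hF : V.F (p + 1) s ≤ V.F p s := V.F_anti s (by omega)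
  have h1 : V.hodgeBundle I p s ⊔ V.F (p + 1) s = V.F p s := by
    rw [← hI.F_inf_opposed, sup_comm, inf_comm, ← sup_inf_assoc_of_le _ hF,
      (hI.isCompl rfl s).sup_eq_top, top_inf_eq]
  have h2 : V.hodgeBundle I p s ⊓ V.F (p + 1) s = ⊥ := by
    rw [← hI.F_inf_opposed, inf_assoc, inf_comm (V.opposed I p s),
      (hI.isCompl rfl s).inf_eq_bot, inf_bot_eq]
  rw [← Submodule.finrank_sup_add_finrank_inf_eq, h1, h2, finrank_bot, add_zero]

theorem isSmoothSubbundle (hI : V.IsBigrading I) (p : ℤ) :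
    V.VQ.complexify.IsSmoothSubbundle E (V.hodgeBundle I p) := by
  intro x
  obtain ⟨f⟩ := hI.exists_adaptedFrame x
  -- Away from x the frame sections may leave U^p. Projecting them back keeps them smooth, and they
  -- stay independent near x; the rank of U^p is rank F^p - rank F^{p+1}, so they still span.
  let u : {i // (f.deg i).1 = p} → ∀ s, V.VQ.complexify.fiber s :=
    fun i s => hI.component p s (f.sec i s)
  have hspan : Submodule.span ℂ (Set.range fun i : {i // (f.deg i).1 = p} => f.sec i x) =
      V.hodgeBundle I p x := f.span_eq {i | i.1 = p}
  have hux : (fun i => u i x) = fun i : {i // (f.deg i).1 = p} => f.sec i x :=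
    funext fun i => hI.component_of_mem (hspan ▸ Submodule.subset_span ⟨i, rfl⟩)
  have hlx : LinearIndependent ℂ fun i => u i x := by
    rw [hux]
    exact f.linearIndependent_subtype _
  have hli := V.VQ.complexify.eventually_linearIndependent (b := u) (x := x)
    (fun i => hI.component_smoothAt p (f.smoothAt i)) hlx
  have hsm : ∀ᶠ s in 𝓝 x, ∀ i, V.VQ.complexify.SmoothAt E (u i) s := by
    refine eventually_all.2 fun i => (f.holomorphic i).mono fun s hs => ?_
    exact hI.component_smoothAt p (V.VQ.complexify.smoothAt_of_holomorphicAt hs)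
  have hev := hli.and (hsm.and ((V.eventually_finrank_F p x).and
    (V.eventually_finrank_F (p + 1) x)))
  obtain ⟨O, hO, hOo, hxO⟩ := mem_nhds_iff.1 hev
  let e := Fintype.equivFin {i // (f.deg i).1 = p}
  refine ⟨O, hOo, hxO, _, fun k => u (e.symm k), fun k s hs => (hO hs).2.1 _, fun s hs => ?_⟩
  obtain ⟨h1, -, h2, h3⟩ := hO hs
  refine ⟨h1.comp _ e.symm.injective, ?_⟩
  rw [show (Set.range fun k => u (e.symm k) s) = Set.range fun i => u i s from
    e.symm.surjective.range_comp fun i => u i s]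
  refine Submodule.eq_of_le_of_finrank_eq (Submodule.span_le.2 ?_) ?_
  · rintro _ ⟨i, rfl⟩
    exact hI.component_mem p s _
  · have h4 := hI.finrank_hodgeBundle p s
    have h5 := hI.finrank_hodgeBundle p x
    have h6 : Module.finrank ℂ (V.hodgeBundle I p s) = Module.finrank ℂ (V.hodgeBundle I p x) :=
      Nat.add_right_cancel (h4.trans ((h2.trans h5.symm).trans (congrArg (_ + ·) h3.symm)))
    rw [h6, finrank_span_eq_card h1, ← hspan, ← hux]
    exact (finrank_span_eq_card hlx).symm

theorem isInternal_hodgeBundle (hI : V.IsBigrading I) (s : S) :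
    DirectSum.IsInternal fun p => V.hodgeBundle I p s := by
  rw [DirectSum.isInternal_submodule_iff_iSupIndep_and_iSup_eq_top]
  obtain ⟨M, hM⟩ := (V.isMixedHodge s).weight_top
  refine ⟨(hI s).iSupIndep_fst, top_le_iff.1 ?_⟩
  rw [← (hI s).supOver_univ hM]
  exact supOver_le fun i _ => le_iSup_of_le i.1 (le_supOver (Λ := {j : ℤ × ℤ | j.1 = i.1}) rfl)

end IsBigrading

end VGPMHS

/-! ## Horizontality -/

namespace VGPMHS

variable {E : Type w} [NormedAddCommGroup E] [NormedSpace ℂ E]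
  {S : Type u} [TopologicalSpace S] [ChartedSpace E S] {V : VGPMHS.{u, v, w} E S}
  {I : ∀ s, ℤ × ℤ → Submodule ℂ (V.VQ.complexify.fiber s)} {x : S}

namespace AdaptedFrame

variable (f : V.AdaptedFrame I x)

theorem nabla_mem_F (i : f.ι) (ξ : E) :
    V.VQ.complexify.nabla E (f.sec i) x ξ ∈ V.F ((f.deg i).1 - 1) x := by
  obtain ⟨O, hO, hOo, hxO⟩ := mem_nhds_iff.1 ((f.holomorphic i).and (f.mem_F i))
  exact V.F_transversal _ O hOo (f.sec i) (fun s hs => hO hs) x hxO ξ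

theorem nabla_mem_WC (i : f.ι) (ξ : E) :
    V.VQ.complexify.nabla E (f.sec i) x ξ ∈ V.WC ((f.deg i).1 + (f.deg i).2) x := by
  refine V.VQ.complexify.nabla_mem (f.smoothAt i) ?_ ξ
  filter_upwards [f.mem_W i,
    V.VQ.isFlatSub_baseChange (V.W_flat ((f.deg i).1 + (f.deg i).2)) x] with s h1 h2
  exact h2.le (Submodule.mem_map_of_mem h1)

/-- ∇ moves F^a ∩ W_{a+b} into F^{a-1} ∩ W_{a+b}, where the complementary index is b + 1 ≤ p + 1. -/
theorem nabla_conj_mem_opposed (hI : V.IsBigrading I) {p : ℤ} (i : f.ι) (hi : (f.deg i).2 ≤ p)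
    (ξ : E) :
    V.VQ.complexify.nabla E (V.VQ.conjSection (f.sec i)) x ξ ∈ V.opposed I (p + 1) x := by
  obtain ⟨m, hm⟩ := (V.isMixedHodge x).weight_bot
  rw [V.VQ.nabla_conjSection (f.smoothAt i)]
  refine (hI x).conj_hodge_inf_le hm (V.isMixedHodge x).conj_weight (a := (f.deg i).1 - 1)
    (k := (f.deg i).1 + (f.deg i).2) (by omega) ⟨?_, ?_⟩
  · exact Hodge.conj_mem_conjSub (f.nabla_mem_F i ξ)
  · exact Hodge.conj_mem_baseChange (f.nabla_mem_WC i ξ)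

theorem nabla_conj_smul (i : f.ι) (c : ℂ) (ξ : E) :
    V.VQ.complexify.nabla E (V.VQ.conjSection (f.sec i)) x (c • ξ) =
      starRingEnd ℂ c • V.VQ.complexify.nabla E (V.VQ.conjSection (f.sec i)) x ξ := by
  rw [V.VQ.nabla_conjSection (f.smoothAt i), V.VQ.nabla_conjSection (f.smoothAt i),
    V.VQ.complexify.nabla_smul_of_holomorphicAt (f.holomorphic i).self_of_nhds, map_smulₛₗ]

end AdaptedFrame

namespace IsBigrading

theorem nabla_mem_F (hI : V.IsBigrading I) {p : ℤ} {σ : ∀ s, V.VQ.complexify.fiber s}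
    (hσ : V.VQ.complexify.SmoothAt E σ x) (hp : ∀ᶠ s in 𝓝 x, σ s ∈ V.F p s) (ξ : E) :
    V.VQ.complexify.nabla E σ x ξ ∈ V.F (p - 1) x ∧
      V.VQ.complexify.nabla E σ x (Complex.I • ξ) -
        Complex.I • V.VQ.complexify.nabla E σ x ξ ∈ V.F p x := by
  obtain ⟨f⟩ := hI.exists_adaptedFrame x
  have hspan := f.eventually_span_F hI p
  obtain ⟨c, hc⟩ := V.VQ.complexify.exists_coeff
    (b := fun i : {i // p ≤ (f.deg i).1} => f.sec i) (σ := σ) (x := x) <| by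
      filter_upwards [hspan, hp] with s h1 h2
      exact h1.ge h2
  have hsm := fun i : {i // p ≤ (f.deg i).1} => f.smoothAt i
  have hcr := V.VQ.complexify.coeff_mem_regularFunctions hsm (f.linearIndependent_subtype _) hσ hc
  have hmem : ∀ i : {i // p ≤ (f.deg i).1}, f.sec i x ∈ V.F p x := fun i =>
    hspan.self_of_nhds.le (Submodule.subset_span ⟨i, rfl⟩)
  have hle : V.F p x ≤ V.F (p - 1) x := V.F_anti x (by omega)
  rw [V.VQ.complexify.nabla_sum hsm hcr hc, V.VQ.complexify.nabla_sum hsm hcr hc]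
  constructor
  · exact Submodule.sum_mem _ fun i _ => add_mem (Submodule.smul_mem _ _ (hle (hmem i)))
      (Submodule.smul_mem _ _ (V.F_anti x (by have := i.2; omega) (f.nabla_mem_F i ξ)))
  -- In the defect of complex linearity the terms c_i ∇e_i cancel, since e_i is holomorphic; only
  -- derivatives of coefficients times e_i remain, and these lie in F^p.
  · rw [Finset.smul_sum, ← Finset.sum_sub_distrib]
    refine Submodule.sum_mem _ fun i _ => ?_
    rw [V.VQ.complexify.nabla_smul_of_holomorphicAt (f.holomorphic i).self_of_nhds, smul_add,
      smul_comm (c i x), add_sub_add_right_eq_sub]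
    exact sub_mem (Submodule.smul_mem _ _ (hmem i))
      (Submodule.smul_mem _ _ (Submodule.smul_mem _ _ (hmem i)))

theorem nabla_mem_opposed (hI : V.IsBigrading I) {p : ℤ} {σ : ∀ s, V.VQ.complexify.fiber s}
    (hσ : V.VQ.complexify.SmoothAt E σ x) (hp : ∀ᶠ s in 𝓝 x, σ s ∈ V.opposed I p s) (ξ : E) :
    V.VQ.complexify.nabla E σ x ξ ∈ V.opposed I (p + 1) x ∧
      V.VQ.complexify.nabla E σ x (Complex.I • ξ) +
        Complex.I • V.VQ.complexify.nabla E σ x ξ ∈ V.opposed I p x := by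
  obtain ⟨f⟩ := hI.exists_adaptedFrame x
  have hspan := f.eventually_span_opposed hI p
  obtain ⟨c, hc⟩ := V.VQ.complexify.exists_coeff
    (b := fun i : {i // (f.deg i).2 ≤ p} => V.VQ.conjSection (f.sec i)) (σ := σ) (x := x) <| by
      filter_upwards [hspan, hp] with s h1 h2
      exact h1.ge h2
  have hsm := fun i : {i // (f.deg i).2 ≤ p} => V.VQ.smoothAt_conjSection (f.smoothAt i)
  have hcr := V.VQ.complexify.coeff_mem_regularFunctions hsm (f.linearIndependent_conj _) hσ hc
  have hmem : ∀ i : {i // (f.deg i).2 ≤ p}, V.VQ.conjSection (f.sec i) x ∈ V.opposed I p x :=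
    fun i => hspan.self_of_nhds.le (Submodule.subset_span ⟨i, rfl⟩)
  have hle : V.opposed I p x ≤ V.opposed I (p + 1) x := opposed_mono (by omega) x
  rw [V.VQ.complexify.nabla_sum hsm hcr hc, V.VQ.complexify.nabla_sum hsm hcr hc]
  constructor
  · exact Submodule.sum_mem _ fun i _ => add_mem (Submodule.smul_mem _ _ (hle (hmem i)))
      (Submodule.smul_mem _ _ (f.nabla_conj_mem_opposed hI i i.2 ξ))
  -- The same cancellation with the opposite sign: ∇ of a conjugated holomorphic section is
  -- conjugate linear.
  · rw [Finset.smul_sum, ← Finset.sum_add_distrib]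
    refine Submodule.sum_mem _ fun i _ => ?_
    rw [f.nabla_conj_smul, Complex.conj_I, smul_add, smul_comm (c i x), neg_smul,
      add_add_add_comm, neg_add_cancel, add_zero]
    exact add_mem (Submodule.smul_mem _ _ (hmem i))
      (Submodule.smul_mem _ _ (Submodule.smul_mem _ _ (hmem i)))

variable [IsManifold 𝓘(ℂ, E) ω S]

theorem smoothFormAt_component (hI : V.IsBigrading I) (p : ℤ)
    {α : ∀ s : S, E →ₗ[ℝ] V.VQ.complexify.fiber s} (h : V.VQ.complexify.SmoothFormAt E α x) :
    V.VQ.complexify.SmoothFormAt E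
      (fun s => (hI.component p s).restrictScalars ℝ ∘ₗ α s) x :=
  fun v => hI.component_smoothAt p (h v)

theorem isForm01_component (hI : V.IsBigrading I) (p : ℤ) {O : Set S}
    {α : ∀ s : S, E →ₗ[ℝ] V.VQ.complexify.fiber s}
    (h : ∀ s ∈ O, V.VQ.complexify.SmoothFormAt E α s) :
    V.VQ.complexify.IsForm01 E O (V.hodgeBundle I p)
      (fun s => (hI.component p s).restrictScalars ℝ ∘ₗ antilinearPart (α s)) where
  smooth s hs := hI.smoothFormAt_component p (h s hs).antilinearPart
  mem s _ _ := hI.component_mem p s _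
  conjLinear s _ c ξ := (congrArg (hI.component p s) (antilinearPart_smul (α s) c ξ)).trans
    ((hI.component p s).map_smul _ _)

theorem isForm10_component (hI : V.IsBigrading I) (p : ℤ) {O : Set S}
    {α : ∀ s : S, E →ₗ[ℝ] V.VQ.complexify.fiber s}
    (h : ∀ s ∈ O, V.VQ.complexify.SmoothFormAt E α s) :
    V.VQ.complexify.IsForm10 E O (V.hodgeBundle I p)
      (fun s => (hI.component p s).restrictScalars ℝ ∘ₗ linearPart (α s)) where
  smooth s hs := hI.smoothFormAt_component p (h s hs).linearPart
  mem s _ _ := hI.component_mem p s _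
  linear s _ c ξ := (congrArg (hI.component p s) (linearPart_smul (α s) c ξ)).trans
    ((hI.component p s).map_smul _ _)

theorem isComplexVHS (hI : V.IsBigrading I) :
    V.VQ.complexify.IsComplexVHS E (V.hodgeBundle I) where
  smooth := hI.isSmoothSubbundle
  isInternal := hI.isInternal_hodgeBundle
  horizontal p O hO σ hσ := by
    have hα : ∀ s ∈ O, V.VQ.complexify.SmoothFormAt E (V.VQ.complexify.nabla E σ) s := fun s hs =>
      V.VQ.complexify.smoothFormAt_nabla (eventually_of_mem (hO.mem_nhds hs) fun t ht => (hσ t ht).1)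
    refine ⟨_, _, _, _, hI.isForm01_component (p + 1) hα, hI.isForm01_component p hα,
      hI.isForm10_component p hα, hI.isForm10_component (p - 1) hα, fun s hs => ?_⟩
    have hF := hI.nabla_mem_F (p := p) (hσ s hs).1 <| by
      filter_upwards [hO.mem_nhds hs] with t ht
      exact ((hI.F_inf_opposed p t).ge (hσ t ht).2).1
    have hG := hI.nabla_mem_opposed (p := p) (hσ s hs).1 <| by
      filter_upwards [hO.mem_nhds hs] with t ht
      exact ((hI.F_inf_opposed p t).ge (hσ t ht).2).2
    refine LinearMap.ext fun ξ => ?_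
    -- The (0,1)-part lies in F^p ∩ G^{p+1}, and in `h2` the (1,0)-part lies in F^{p-1} ∩ G^p; each
    -- is the sum of its two Hodge components.
    have h1 := hI.component_add_component (rfl : p + 1 = p + 1)
      (antilinearPart_mem (hF ξ).2)
      (antilinearPart_mem_of_forall (A := V.opposed I (p + 1) s) (fun η => (hG η).1) ξ)
    have h2 := hI.component_add_component (sub_add_cancel p 1)
      (linearPart_mem_of_forall (A := V.F (p - 1) s) (fun η => (hF η).1) ξ)
      (linearPart_mem (hG ξ).2)
    refine (antilinearPart_add_linearPart (V.VQ.complexify.nabla E σ s) ξ).symm.trans ?_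
    refine (congrArg₂ (· + ·) h1.symm h2.symm).trans ?_
    exact (add_assoc _ _ _).symm

end IsBigrading

end VGPMHS

end

theorem theorem5p1 {E : Type w} [NormedAddCommGroup E] [NormedSpace ℂ E] [FiniteDimensional ℂ E]
    {S : Type u} [TopologicalSpace S] [ChartedSpace E S] [IsManifold 𝓘(ℂ, E) ω S]
    (V : VGPMHS.{u, v, w} E S) :
    ∃ I : ∀ s, ℤ → ℤ → Submodule ℂ (ℂ ⊗[ℚ] V.VQ.fiber s),
      (∀ s J, Hodge.IsDeligneBigrading (fun p => V.F p s) (fun k => V.W k s) J ↔ J = I s) ∧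
      V.VQ.complexify.IsComplexVHS E (fun p s => ⨆ q : ℤ, I s p q) := by
  choose I hI using fun s => (V.isMixedHodge s).exists_isBigrading
  refine ⟨fun s p q => I s (p, q), fun s J => ?_, ?_⟩
  · rw [Hodge.isDeligneBigrading_iff (V.W_exists_eq_top s)]
    constructor
    · intro h
      obtain ⟨m, hm⟩ := (V.isMixedHodge s).weight_bot
      have := IsBigrading.unique h (hI s) hm (V.isMixedHodge s).conj_weight
      funext p q
      exact congrFun this (p, q)
    · rintro rfl
      exact hI s
  · have hb : V.IsBigrading I := hI
    convert hb.isComplexVHS using 3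
    exact iSup_eq_supOver _
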